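/- Let $0\le\omega<1$, $-\pi/2<\theta_0<\pi/2$, $\mu_0=\cos\theta_0$, and write $\mu=\cos\theta$. Let $\psi_d(\theta,\tau)$ ($-\pi<\theta<\pi$, $\tau\ge0$) be a real solution of the half-space transport equation with isotropic cylindrical scattering $$\mu\,\frac{\partial\psi_d}{\partial\tau}(\theta,\tau)+\psi_d(\theta,\tau)=\frac{\omega}{2\pi}\int_{-\pi}^{\pi}\psi_d(\theta',\tau)\,d\theta'+\frac{\omega}{2\pi}e^{-\tau/\mu_0}\qquad(\tau>0,\ \mu\ne0),$$ with $\psi_d(\cdot,\tau)$ integrable for each $\tau>0$, $\psi_d(\theta,\cdot)$ continuous at $\tau=0$ whenever $\mu\neq0$, and no re-entrant diffuse flux: $\psi_d(\theta,0)=0$ for $|\theta|<\pi/2$. Assume that its Laplace transforms exist in the right half-plane: for every $\sigma>0$, $e^{-\sigma\tau}\psi_d(\theta,\tau)$ is integrable in $\tau\in(0,\infty)$ for each $\theta$ with $\mu\ne0$, and integrable in $(\theta,\tau)\in(-\pi,\pi)\times(0,\infty)$. Put $\rho_d(\tau)=\int_{-\pi}^{\pi}\psi_d(\theta,\tau)\,d\theta$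 and $\hat\rho_d(s)=\int_0^\infty e^{-s\tau}\rho_d(\tau)\,d\tau$. Let $\sqrt{s^2-1}$ be the branch with cuts along the real axis from $1$ to $+\infty$ and from $-1$ to $-\infty$ for which $i\sqrt{s^2-1}<0$ on $(-1,1)$. Let $s_+=\sqrt{1-\omega^2}$, fix $0<\beta<s_+$, and set $$\kappa(s)=\frac{(s^2-1)\{\sqrt{s^2-1}-i\omega\}}{(s^2-s_+^2)\sqrt{s^2-1}},\qquad \kappa_\pm(s)=\exp\left(\frac1{2\pi i}\int_{\pm\beta-i\infty}^{\pm\beta+i\infty}\frac{\operatorname{Log}\kappa(\zeta)}{\zeta-s}\,d\zeta\right),$$ with $\operatorname{Log}$ the principal logarithm. Then: 1. For $|\Re s|<1$, $\displaystyle I=\int_{-\pi}^{\pi}\frac{d\theta}{1+s\mu}=\frac{2\pi i}{\sqrt{s^2-1}}$. 2. The contour integral for $\kappa_+(s)$ converges absolutely for $\Re s<\beta$, that for $\kappa_-(s)$ for $\Re s>-\beta$. The functions $\kappa_+$ and $\kappa_-$ are analytic in these respective half-planes, and $\kappa(s)=\kappa_+(s)/\kappa_-(s)$ for $|\Re s|<\beta$.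 3. For $\Re s>0$, $$\hat\rho_d(s)=\frac{\mu_0(1+\mu_0)}{\kappa_+(-1/\mu_0)(1+\mu_0s_+)}\,\frac{(s+1)\kappa_-(s)}{(s+s_+)(1+\mu_0s)}-\frac{\mu_0}{1+\mu_0s}.$$ 4. For $\pi/2<|\theta|<\pi$, so that $-1<\mu<0$, the emergent diffuse flux is $$\psi_d(\theta,0)=-\frac{\omega}{2\pi\mu}\hat\rho_d(-1/\mu)+\frac{\omega}{2\pi}\frac{\mu_0}{\mu_0-\mu}=\frac{\omega}{2\pi}\frac{\mu_0(1+\mu_0)(1-\mu)\,\kappa_-(-1/\mu)}{(\mu_0-\mu)(1+\mu_0s_+)(1-\mu s_+)\,\kappa_+(-1/\mu_0)}$$ $$=\frac{\omega}{2\pi}\frac{\mu_0(1+\mu_0)(1-\mu)}{(\mu_0-\mu)(1+\mu_0s_+)(1-\mu s_+)}\,\kappa_-(1/\mu_0)\kappa_-(-1/\mu)=\frac{\omega}{2\pi}\frac{\mu_0(1+\mu_0)(1-\mu)}{(\mu_0-\mu)(1+\mu_0s_+)(1-\mu s_+)}\,\frac{1}{\kappa_+(-1/\mu_0)\,\kappa_+(1/\mu)}.$$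 -/

import Mathlib

open MeasureTheory Set Filter Topology

noncomputable section

namespace Albedo

/-- The diffuse photon density `ρ_d(τ) = ∫_{-π}^{π} ψ_d(θ, τ) dθ` (up to the speed of light). -/
def photonDensity (ψ : ℝ → ℝ → ℝ) (τ : ℝ) : ℝ :=
  ∫ θ in (-Real.pi)..Real.pi, ψ θ τ

/-- The one-sided Laplace transform `∫_0^∞ e^{-sτ} f(τ) dτ`. -/
def laplace (f : ℝ → ℝ) (s : ℂ) : ℂ :=
  ∫ τ in Ioi (0 : ℝ), Complex.exp (-s * (τ : ℂ)) * (f τ : ℂ)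

/-- `ψ θ τ` is a diffuse flux in the half space `τ ≥ 0` with isotropic cylindrical scattering,
single-scattering albedo `ω` and incidence angle `θ₀`. With `μ = cos θ` and `μ₀ = cos θ₀`, it solves
`μ ∂ψ/∂τ + ψ = (ω/2π) ∫ ψ(θ', τ) dθ' + (ω/2π) e^{-τ/μ₀}` for `τ > 0`, is continuous up to `τ = 0`,
vanishes at `τ = 0` in the inward directions, and possesses (absolutely convergent) Laplace
transforms in the right half-plane, both at fixed angle and jointly in angle and depth.
The grazing angles `μ = 0` (a null set of directions) are left unconstrained. -/
structure IsDiffuseFlux (ω θ₀ : ℝ) (ψ : ℝ → ℝ → ℝ) : Prop where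
  integrable_angle : ∀ τ : ℝ, 0 < τ →
    IntegrableOn (fun θ => ψ θ τ) (Ioo (-Real.pi) Real.pi)
  differentiable : ∀ θ ∈ Ioo (-Real.pi) Real.pi, Real.cos θ ≠ 0 → ∀ τ : ℝ, 0 < τ →
    DifferentiableAt ℝ (ψ θ) τ
  transport : ∀ θ ∈ Ioo (-Real.pi) Real.pi, Real.cos θ ≠ 0 → ∀ τ : ℝ, 0 < τ →
    Real.cos θ * deriv (ψ θ) τ + ψ θ τ =
      ω / (2 * Real.pi) * (∫ θ' in (-Real.pi)..Real.pi, ψ θ' τ)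
        + ω / (2 * Real.pi) * Real.exp (-τ / Real.cos θ₀)
  continuous_boundary : ∀ θ ∈ Ioo (-Real.pi) Real.pi, Real.cos θ ≠ 0 →
    ContinuousWithinAt (ψ θ) (Ici 0) 0
  no_reentrant : ∀ θ : ℝ, |θ| < Real.pi / 2 → ψ θ 0 = 0
  laplace_angle : ∀ θ ∈ Ioo (-Real.pi) Real.pi, Real.cos θ ≠ 0 → ∀ σ : ℝ, 0 < σ →
    IntegrableOn (fun τ => Real.exp (-σ * τ) * ψ θ τ) (Ioi 0)
  laplace_joint : ∀ σ : ℝ, 0 < σ →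
    IntegrableOn (fun p : ℝ × ℝ => Real.exp (-σ * p.2) * ψ p.1 p.2)
      (Ioo (-Real.pi) Real.pi ×ˢ Ioi (0 : ℝ))

/-- The branch of `√(s² - 1) = √(s - 1) √(s + 1)` with cuts from `1` to `+∞` and from `-1` to `-∞`
along the real axis, for which `i √(s² - 1)` is real and negative on `(-1, 1)`. The powers on the
right are principal ones. -/
def branchSqrt (s : ℂ) : ℂ :=
  Complex.I * ((1 - s) ^ (1 / 2 : ℂ) * (1 + s) ^ (1 / 2 : ℂ))

/-- `s₊ = √(1 - ω²)`. -/
def sPlus (ω : ℝ) : ℝ := Real.sqrt (1 - ω ^ 2)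

/-- `κ(s) = (s² - 1)(√(s² - 1) - iω) / ((s² - s₊²) √(s² - 1))`. -/
def kappa (ω : ℝ) (s : ℂ) : ℂ :=
  ((s ^ 2 - 1) * (branchSqrt s - Complex.I * (ω : ℂ))) /
    ((s ^ 2 - (sPlus ω : ℂ) ^ 2) * branchSqrt s)

/-- The function of `t` whose integral over `ℝ` is the contour integral
`∫_{c - i∞}^{c + i∞} Log κ(ζ) / (ζ - s) dζ`, through `ζ = c + i t`, `dζ = i dt`. -/
def contourIntegrand (ω c : ℝ) (s : ℂ) (t : ℝ) : ℂ :=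
  Complex.log (kappa ω ((c : ℂ) + Complex.I * (t : ℂ))) /
    (((c : ℂ) + Complex.I * (t : ℂ)) - s) * Complex.I

/-- `exp ((1 / 2πi) ∫_{c - i∞}^{c + i∞} Log κ(ζ) / (ζ - s) dζ)`. -/
def cauchyExp (ω c : ℝ) (s : ℂ) : ℂ :=
  Complex.exp (1 / (2 * (Real.pi : ℂ) * Complex.I) * ∫ t : ℝ, contourIntegrand ω c s t)

/-- The Wiener-Hopf factor `κ₊`, with its contour along `Re ζ = β`. -/
def kappaPlus (ω β : ℝ) (s : ℂ) : ℂ := cauchyExp ω β s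

/-- The Wiener-Hopf factor `κ₋`, with its contour along `Re ζ = -β`. -/
def kappaMinus (ω β : ℝ) (s : ℂ) : ℂ := cauchyExp ω (-β) s

end Albedo

end

namespace Albedo

open Complex

/-- The square root of `1 - s²` with positive real part on the strip `|Re s| < 1`. -/
noncomputable def stripSqrt (s : ℂ) : ℂ := (1 - s) ^ (1 / 2 : ℂ) * (1 + s) ^ (1 / 2 : ℂ)

lemma branchSqrt_eq (s : ℂ) : branchSqrt s = I * stripSqrt s := rfl

lemma re_one_sub_pos {s : ℂ} (hs : |s.re| < 1) : 0 < (1 - s).re := by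
  have := abs_lt.1 hs
  simp only [sub_re, one_re]; linarith

lemma re_one_add_pos {s : ℂ} (hs : |s.re| < 1) : 0 < (1 + s).re := by
  have := abs_lt.1 hs
  simp only [add_re, one_re]; linarith

lemma ne_zero_of_re_pos {z : ℂ} (hz : 0 < z.re) : z ≠ 0 := by
  rintro rfl; simp at hz

lemma stripSqrt_sq (s : ℂ) : stripSqrt s ^ 2 = 1 - s ^ 2 := by
  have h (z : ℂ) : (z ^ (1 / 2 : ℂ)) ^ 2 = z := by
    simp
  rw [stripSqrt, mul_pow, h, h]; ring

lemma stripSqrt_re_pos {s : ℂ} (hs : |s.re| < 1) : 0 < (stripSqrt s).re := by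
  have h₁ := abs_lt.1 (abs_arg_lt_pi_div_two_iff.2 (Or.inl (re_one_sub_pos hs)))
  have h₂ := abs_lt.1 (abs_arg_lt_pi_div_two_iff.2 (Or.inl (re_one_add_pos hs)))
  rw [stripSqrt, cpow_def_of_ne_zero (ne_zero_of_re_pos (re_one_sub_pos hs)),
    cpow_def_of_ne_zero (ne_zero_of_re_pos (re_one_add_pos hs)), ← Complex.exp_add, exp_re]
  refine mul_pos (Real.exp_pos _) (Real.cos_pos_of_mem_Ioo ?_)
  have : (log (1 - s) * (1 / 2) + log (1 + s) * (1 / 2)).im = (arg (1 - s) + arg (1 + s)) / 2 := by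
    have e : (1 / 2 : ℂ) = ((1 / 2 : ℝ) : ℂ) := by push_cast; rfl
    rw [e, add_im, im_mul_ofReal, im_mul_ofReal, log_im, log_im]; ring
  rw [this]
  constructor <;> linarith

lemma stripSqrt_ne_zero {s : ℂ} (hs : |s.re| < 1) : stripSqrt s ≠ 0 :=
  ne_zero_of_re_pos (stripSqrt_re_pos hs)

lemma differentiableAt_stripSqrt {s : ℂ} (hs : |s.re| < 1) : DifferentiableAt ℂ stripSqrt s := by
  refine DifferentiableAt.mul ?_ ?_
  · exact DifferentiableAt.cpow (by fun_prop) (by fun_prop) (Or.inl (re_one_sub_pos hs))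
  · exact DifferentiableAt.cpow (by fun_prop) (by fun_prop) (Or.inl (re_one_add_pos hs))

lemma sPlus_le_one (ω : ℝ) : sPlus ω ≤ 1 := by
  rw [sPlus]; exact Real.sqrt_le_one.2 (by nlinarith [sq_nonneg ω])

lemma sPlus_sq {ω : ℝ} (h₀ : 0 ≤ ω) (h₁ : ω < 1) : sPlus ω ^ 2 = 1 - ω ^ 2 :=
  Real.sq_sqrt (by nlinarith)

/-- The elementary relation behind the Wiener-Hopf equation. -/
lemma one_sub_div_stripSqrt {ω : ℝ} (h₀ : 0 ≤ ω) (h₁ : ω < 1) {s : ℂ} (hs : |s.re| < sPlus ω) :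
    1 - (ω : ℂ) / stripSqrt s =
      (1 + (ω : ℂ) / stripSqrt s)⁻¹ * ((s ^ 2 - (sPlus ω : ℂ) ^ 2) / (s ^ 2 - 1)) := by
  have hs1 : |s.re| < 1 := hs.trans_le (sPlus_le_one ω)
  have hw := stripSqrt_ne_zero hs1
  have hwre := stripSqrt_re_pos hs1
  have hsq := stripSqrt_sq s
  have hp : ((sPlus ω : ℝ) : ℂ) ^ 2 = 1 - (ω : ℂ) ^ 2 := by exact_mod_cast sPlus_sq h₀ h₁
  have hwo : stripSqrt s + ω ≠ 0 := ne_zero_of_re_pos (by simp; linarith)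
  have h1 : s ^ 2 - 1 = - stripSqrt s ^ 2 := by rw [hsq]; ring
  have h2 : s ^ 2 - (sPlus ω : ℂ) ^ 2 = (ω : ℂ) ^ 2 - stripSqrt s ^ 2 := by rw [hsq, hp]; ring
  have h3 : 1 + (ω : ℂ) / stripSqrt s = (stripSqrt s + ω) / stripSqrt s := by field_simp
  rw [h1, h2, h3, inv_div]
  field_simp
  ring

lemma kappa_eq {ω : ℝ} (h₀ : 0 ≤ ω) (h₁ : ω < 1) {s : ℂ} (hs : |s.re| < sPlus ω) :
    kappa ω s = (1 + (ω : ℂ) / stripSqrt s)⁻¹ := by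
  have hs1 : |s.re| < 1 := hs.trans_le (sPlus_le_one ω)
  have hw := stripSqrt_ne_zero hs1
  have hsq := stripSqrt_sq s
  have hk := one_sub_div_stripSqrt h₀ h₁ hs
  have hp0 : s ^ 2 - (sPlus ω : ℂ) ^ 2 ≠ 0 := by
    intro h
    have h' : s ^ 2 = (sPlus ω : ℂ) ^ 2 := sub_eq_zero.1 h
    rcases sq_eq_sq_iff_eq_or_eq_neg.1 h' with h | h
    · rw [h, ofReal_re] at hs; exact absurd (le_abs_self _) (not_le.2 hs)
    · rw [h, neg_re, ofReal_re, abs_neg] at hs; exact absurd (le_abs_self _) (not_le.2 hs)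
  have h10 : s ^ 2 - 1 ≠ 0 := by
    rw [← neg_sub, ← hsq]; exact neg_ne_zero.2 (pow_ne_zero _ hw)
  have e : kappa ω s = (1 - (ω : ℂ) / stripSqrt s) * ((s ^ 2 - 1) / (s ^ 2 - (sPlus ω : ℂ) ^ 2)) := by
    rw [kappa, branchSqrt_eq]
    field_simp
  rw [e, hk]
  field_simp

lemma re_div_nonneg {ω : ℝ} (h₀ : 0 ≤ ω) {w : ℂ} (hw : 0 < w.re) : 0 ≤ ((ω : ℂ) / w).re := by
  rw [div_eq_mul_inv, re_ofReal_mul, inv_re]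
  have := normSq_nonneg w
  positivity

lemma norm_log_one_add_le {u : ℂ} (hu : 0 ≤ u.re) : ‖log (1 + u)‖ ≤ ‖u‖ := by
  have hpos : ∀ z ∈ {z : ℂ | 0 ≤ z.re}, 0 < (1 + z).re := by
    intro z hz; have : 0 ≤ z.re := hz; simp; linarith
  have := Convex.norm_image_sub_le_of_norm_hasDerivWithin_le (𝕜 := ℂ) (f := fun z => log (1 + z))
    (f' := fun z => (1 + z)⁻¹) (s := {z : ℂ | 0 ≤ z.re}) (x := 0) (y := u) (C := 1)
    (fun z hz => by
      have h := (((hasDerivAt_id z).const_add 1).clog (Or.inl (hpos z hz))).hasDerivWithinAt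
        (s := {z : ℂ | 0 ≤ z.re})
      simpa using h)
    (fun z hz => by
      rw [norm_inv]
      refine inv_le_one_of_one_le₀ ((?_ : (1 : ℝ) ≤ (1 + z).re).trans (re_le_norm _))
      have : 0 ≤ z.re := hz
      simp; linarith)
    (convex_halfSpace_re_ge 0) (by simp) hu
  simpa using this

/-- The logarithm of `κ` on the strip of analyticity. -/
lemma log_kappa {ω : ℝ} (h₀ : 0 ≤ ω) (h₁ : ω < 1) {s : ℂ} (hs : |s.re| < sPlus ω) :
    log (kappa ω s) = -log (1 + (ω : ℂ) / stripSqrt s) := by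
  rw [kappa_eq h₀ h₁ hs, log_inv]
  have h := re_div_nonneg h₀ (stripSqrt_re_pos (hs.trans_le (sPlus_le_one ω)))
  have h' : 0 < (1 + (ω : ℂ) / stripSqrt s).re := by simp only [add_re, one_re]; linarith
  have := (abs_lt.1 (abs_arg_lt_pi_div_two_iff.2 (Or.inl h'))).2
  linarith [Real.pi_pos]

lemma kappa_ne_zero {ω : ℝ} (h₀ : 0 ≤ ω) (h₁ : ω < 1) {s : ℂ} (hs : |s.re| < sPlus ω) :
    kappa ω s ≠ 0 := by
  rw [kappa_eq h₀ h₁ hs]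
  have h := re_div_nonneg h₀ (stripSqrt_re_pos (hs.trans_le (sPlus_le_one ω)))
  exact inv_ne_zero (ne_zero_of_re_pos (by simp only [add_re, one_re]; linarith))

lemma differentiableAt_log_kappa {ω : ℝ} (h₀ : 0 ≤ ω) (h₁ : ω < 1) {s : ℂ}
    (hs : |s.re| < sPlus ω) : DifferentiableAt ℂ (fun z => log (kappa ω z)) s := by
  have hs1 := hs.trans_le (sPlus_le_one ω)
  have h := re_div_nonneg h₀ (stripSqrt_re_pos hs1)
  have hd : DifferentiableAt ℂ (fun z => -log (1 + (ω : ℂ) / stripSqrt z)) s := by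
    refine DifferentiableAt.neg (DifferentiableAt.clog ?_ (Or.inl ?_))
    · exact (((differentiableAt_const _).div (differentiableAt_stripSqrt hs1)
        (stripSqrt_ne_zero hs1))).const_add 1
    · simp only [add_re, one_re]; linarith
  refine hd.congr_of_eventuallyEq ?_
  have : ∀ᶠ z : ℂ in 𝓝 s, |z.re| < sPlus ω :=
    (continuous_re.abs.tendsto s).eventually (gt_mem_nhds hs)
  filter_upwards [this] with z hz using log_kappa h₀ h₁ hz

lemma sq_norm_log_kappa_le {ω : ℝ} (h₀ : 0 ≤ ω) (h₁ : ω < 1) {b : ℝ} (hb : b < sPlus ω) {s : ℂ}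
    (hs : |s.re| ≤ b) : ‖log (kappa ω s)‖ ^ 2 ≤ 1 / ((1 - b) ^ 2 + s.im ^ 2) := by
  have hs' := hs.trans_lt hb
  have hb1 := hb.trans_le (sPlus_le_one ω)
  have hs1 := hs.trans_lt hb1
  have hw := stripSqrt_re_pos hs1
  have hA : 0 < (1 - b) ^ 2 + s.im ^ 2 := by have : 0 < 1 - b := by linarith
                                             positivity
  have hwn : (1 - b) ^ 2 + s.im ^ 2 ≤ ‖stripSqrt s‖ ^ 2 := by
    have e : ‖stripSqrt s‖ ^ 2 = ‖1 - s‖ * ‖1 + s‖ := by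
      rw [← norm_pow, stripSqrt_sq s, ← norm_mul]; congr 1; ring
    have hab := abs_le.1 hs
    have e1 : (1 - b) ^ 2 + s.im ^ 2 ≤ ‖1 - s‖ ^ 2 := by
      rw [← normSq_eq_norm_sq, normSq_apply]; simp; nlinarith
    have e2 : (1 - b) ^ 2 + s.im ^ 2 ≤ ‖1 + s‖ ^ 2 := by
      rw [← normSq_eq_norm_sq, normSq_apply]; simp; nlinarith
    rw [e]
    refine abs_le_of_sq_le_sq' ?_ (by positivity) |>.2
    rw [mul_pow, sq ((1 - b) ^ 2 + s.im ^ 2)]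
    exact mul_le_mul e1 e2 hA.le (by positivity)
  have hl : ‖log (kappa ω s)‖ ≤ ‖(ω : ℂ) / stripSqrt s‖ := by
    rw [log_kappa h₀ h₁ hs', norm_neg]
    exact norm_log_one_add_le (re_div_nonneg h₀ hw)
  calc ‖log (kappa ω s)‖ ^ 2 ≤ ‖(ω : ℂ) / stripSqrt s‖ ^ 2 := by gcongr
    _ = ω ^ 2 / ‖stripSqrt s‖ ^ 2 := by
        rw [norm_div, div_pow, norm_real, Real.norm_eq_abs, sq_abs]
    _ ≤ 1 / ((1 - b) ^ 2 + s.im ^ 2) := by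
        gcongr
        nlinarith

lemma stripSqrt_neg (s : ℂ) : stripSqrt (-s) = stripSqrt s := by
  simp only [stripSqrt, sub_neg_eq_add, ← sub_eq_add_neg, mul_comm]

lemma kappa_neg (ω : ℝ) (s : ℂ) : kappa ω (-s) = kappa ω s := by
  simp only [kappa, branchSqrt_eq, stripSqrt_neg, neg_sq]

lemma integrable_inv_sq_add_sq {a : ℝ} (ha : 0 < a) (x₀ : ℝ) :
    Integrable fun t : ℝ => 1 / (a ^ 2 + (t - x₀) ^ 2) := by
  have h := ((integrable_inv_one_add_sq.comp_div ha.ne').comp_sub_right x₀).const_mul (1 / a ^ 2)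
  refine h.congr (ae_of_all _ fun t => ?_)
  have : 0 < a ^ 2 + (t - x₀) ^ 2 := by positivity
  have h2 : 0 < 1 + ((t - x₀) / a) ^ 2 := by positivity
  field_simp

lemma integral_inv_sq_add_sq {a : ℝ} (ha : 0 < a) (x₀ : ℝ) :
    ∫ t : ℝ, 1 / (a ^ 2 + (t - x₀) ^ 2) = Real.pi / a := by
  rw [integral_sub_right_eq_self (fun t : ℝ => 1 / (a ^ 2 + t ^ 2)) x₀]
  have h : (fun t : ℝ => 1 / (a ^ 2 + t ^ 2)) = fun t => 1 / a ^ 2 * (1 + (t / a) ^ 2)⁻¹ := by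
    ext t
    have : 0 < a ^ 2 + t ^ 2 := by positivity
    have h2 : 0 < 1 + (t / a) ^ 2 := by positivity
    field_simp
  rw [h, integral_const_mul, Measure.integral_comp_div (fun t : ℝ => (1 + t ^ 2)⁻¹) a,
    integral_univ_inv_one_add_sq, abs_of_pos ha, smul_eq_mul]
  field_simp

section CauchyIntegral

variable {l : ℝ → ℂ} {a c d : ℝ} {s : ℂ}

lemma norm_line_sub_sq (c : ℝ) (s : ℂ) (t : ℝ) :
    ‖(c : ℂ) + I * t - s‖ ^ 2 = (c - s.re) ^ 2 + (t - s.im) ^ 2 := by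
  rw [← normSq_eq_norm_sq, normSq_apply]; simp; ring

lemma line_sub_ne_zero (hs : s.re ≠ c) (t : ℝ) : (c : ℂ) + I * t - s ≠ 0 := by
  intro h
  have := congrArg re h
  simp at this
  exact hs (by linarith)

lemma norm_cauchy_integrand_le (hl : ∀ t, ‖l t‖ ^ 2 ≤ 1 / (a ^ 2 + t ^ 2)) (hd : 0 < d)
    (hs : d ≤ |c - s.re|) (t : ℝ) :
    ‖l t / ((c : ℂ) + I * t - s) * I‖ ≤
      (1 / (a ^ 2 + (t - 0) ^ 2) + 1 / (d ^ 2 + (t - s.im) ^ 2)) / 2 := by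
  have h1 : (d ^ 2 + (t - s.im) ^ 2) ≤ ‖(c : ℂ) + I * t - s‖ ^ 2 := by
    rw [norm_line_sub_sq, ← sq_abs (c - s.re)]; gcongr
  have h2 : (‖(c : ℂ) + I * t - s‖⁻¹) ^ 2 ≤ 1 / (d ^ 2 + (t - s.im) ^ 2) := by
    rw [inv_pow, one_div]; gcongr
  rw [norm_mul, norm_div, norm_I, mul_one, div_eq_mul_inv, sub_zero]
  nlinarith [hl t, sq_nonneg (‖l t‖ - ‖(c : ℂ) + I * t - s‖⁻¹)]

lemma integrable_cauchy_integrand (hc : Continuous l) (ha : 0 < a)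
    (hl : ∀ t, ‖l t‖ ^ 2 ≤ 1 / (a ^ 2 + t ^ 2)) (hs : s.re ≠ c) :
    Integrable fun t : ℝ => l t / ((c : ℂ) + I * t - s) * I := by
  have hd : 0 < |c - s.re| := abs_pos.2 (sub_ne_zero.2 hs.symm)
  refine Integrable.mono' (((integrable_inv_sq_add_sq ha 0).add
    (integrable_inv_sq_add_sq hd s.im)).div_const 2) ?_
    (ae_of_all _ (norm_cauchy_integrand_le hl hd le_rfl))
  refine Continuous.aestronglyMeasurable ?_
  exact (hc.div (by fun_prop) (line_sub_ne_zero hs)).mul continuous_const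

lemma norm_cauchy_integral_le (ha : 0 < a) (hl : ∀ t, ‖l t‖ ^ 2 ≤ 1 / (a ^ 2 + t ^ 2))
    (hd : 0 < d) (hs : d ≤ |c - s.re|) :
    ‖∫ t : ℝ, l t / ((c : ℂ) + I * t - s) * I‖ ≤ (Real.pi / a + Real.pi / d) / 2 := by
  have i1 := integrable_inv_sq_add_sq ha 0
  have i2 := integrable_inv_sq_add_sq hd s.im
  refine (norm_integral_le_of_norm_le ((i1.add i2).div_const 2)
    (ae_of_all _ (norm_cauchy_integrand_le hl hd hs))).trans_eq ?_
  simp only [Pi.add_apply]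
  rw [integral_div, integral_add i1 i2, integral_inv_sq_add_sq ha, integral_inv_sq_add_sq hd]

lemma differentiableAt_cauchy_integral (hc : Continuous l) (ha : 0 < a)
    (hl : ∀ t, ‖l t‖ ^ 2 ≤ 1 / (a ^ 2 + t ^ 2)) (hs : s.re ≠ c) :
    DifferentiableAt ℂ (fun z => ∫ t : ℝ, l t / ((c : ℂ) + I * t - z) * I) s := by
  set d := |c - s.re| with hd_def
  have hd : 0 < d := abs_pos.2 (sub_ne_zero.2 hs.symm)
  have hne : ∀ z ∈ Metric.ball s (d / 2), z.re ≠ c := by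
    intro z hz h
    rw [Metric.mem_ball, dist_eq] at hz
    have := (abs_re_le_norm (z - s)).trans hz.le
    rw [sub_re, h, ← hd_def] at this
    linarith
  have hlow : ∀ t : ℝ, d ≤ ‖(c : ℂ) + I * t - s‖ := by
    intro t
    have := abs_re_le_norm ((c : ℂ) + I * t - s)
    simpa using this
  have hfar : ∀ z ∈ Metric.ball s (d / 2), ∀ t : ℝ,
      ‖(c : ℂ) + I * t - s‖ / 2 ≤ ‖(c : ℂ) + I * t - z‖ := by
    intro z hz t
    rw [Metric.mem_ball, dist_eq] at hz
    have h2 := norm_add_le ((c : ℂ) + I * t - z) (z - s)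
    rw [sub_add_sub_cancel] at h2
    linarith [hlow t]
  have hcont (n : ℕ) {z : ℂ} (hz : z.re ≠ c) :
      Continuous fun t : ℝ => l t / ((c : ℂ) + I * t - z) ^ n * I :=
    (hc.div (by fun_prop) fun t => pow_ne_zero _ (line_sub_ne_zero hz t)).mul continuous_const
  have key := hasDerivAt_integral_of_dominated_loc_of_deriv_le (μ := volume) (𝕜 := ℂ)
    (F := fun z (t : ℝ) => l t / ((c : ℂ) + I * t - z) * I)
    (F' := fun z (t : ℝ) => l t / ((c : ℂ) + I * t - z) ^ 2 * I)
    (bound := fun t => 4 / d * ‖l t / ((c : ℂ) + I * t - s) * I‖)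
    (Metric.ball_mem_nhds s (half_pos hd))
    (by
      filter_upwards [Metric.ball_mem_nhds s (half_pos hd)] with z hz
      simpa using (hcont 1 (hne z hz)).aestronglyMeasurable)
    (integrable_cauchy_integrand hc ha hl hs)
    (hcont 2 hs).aestronglyMeasurable
    (ae_of_all _ fun t z hz => by
      have h1 := hfar z hz t
      have h2 := hlow t
      have h3 : 0 < ‖(c : ℂ) + I * t - s‖ := hd.trans_le h2
      have h4 : d * ‖(c : ℂ) + I * t - s‖ / 4 ≤ ‖(c : ℂ) + I * t - z‖ ^ 2 := by nlinarith
      rw [norm_mul, norm_mul, norm_div, norm_div, norm_I, mul_one, mul_one, norm_pow]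
      calc ‖l t‖ / ‖(c : ℂ) + I * t - z‖ ^ 2
          ≤ ‖l t‖ / (d * ‖(c : ℂ) + I * t - s‖ / 4) := by gcongr
        _ = 4 / d * (‖l t‖ / ‖(c : ℂ) + I * t - s‖) := by field_simp)
    ((integrable_cauchy_integrand hc ha hl hs).norm.const_mul _)
    (ae_of_all _ fun t z hz => by
      have hz' := line_sub_ne_zero (hne z hz) t
      have h := (((hasDerivAt_const z (l t)).div ((hasDerivAt_id z).const_sub ((c : ℂ) + I * t))
        hz').mul_const I)
      convert! h using 1
      simp)
  exact key.2.differentiableAt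

end CauchyIntegral

section Factors

variable {ω c : ℝ}

lemma continuous_log_kappa_line (h₀ : 0 ≤ ω) (h₁ : ω < 1) (hc : |c| < sPlus ω) :
    Continuous fun t : ℝ => log (kappa ω ((c : ℂ) + I * t)) := by
  refine continuous_iff_continuousAt.2 fun t => ?_
  exact (differentiableAt_log_kappa h₀ h₁ (s := (c : ℂ) + I * t) (by simpa using hc)).continuousAt.comp
    (f := fun t : ℝ => (c : ℂ) + I * t) (by fun_prop)

lemma sq_norm_log_kappa_line_le (h₀ : 0 ≤ ω) (h₁ : ω < 1) (hc : |c| < sPlus ω) (t : ℝ) :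
    ‖log (kappa ω ((c : ℂ) + I * t))‖ ^ 2 ≤ 1 / ((1 - |c|) ^ 2 + t ^ 2) := by
  simpa using sq_norm_log_kappa_le h₀ h₁ hc (s := (c : ℂ) + I * t) (by simp)

lemma one_sub_abs_pos (hc : |c| < sPlus ω) : 0 < 1 - |c| := by
  linarith [sPlus_le_one ω]

lemma integrable_contourIntegrand (h₀ : 0 ≤ ω) (h₁ : ω < 1) (hc : |c| < sPlus ω) {s : ℂ}
    (hs : s.re ≠ c) : Integrable (contourIntegrand ω c s) :=
  integrable_cauchy_integrand (continuous_log_kappa_line h₀ h₁ hc) (one_sub_abs_pos hc)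
    (sq_norm_log_kappa_line_le h₀ h₁ hc) hs

lemma differentiableAt_cauchyExp (h₀ : 0 ≤ ω) (h₁ : ω < 1) (hc : |c| < sPlus ω) {s : ℂ}
    (hs : s.re ≠ c) : DifferentiableAt ℂ (cauchyExp ω c) s :=
  ((differentiableAt_cauchy_integral (continuous_log_kappa_line h₀ h₁ hc) (one_sub_abs_pos hc)
    (sq_norm_log_kappa_line_le h₀ h₁ hc) hs).const_mul _).cexp

lemma cauchyExp_ne_zero (ω c : ℝ) (s : ℂ) : cauchyExp ω c s ≠ 0 := exp_ne_zero _

/-- Away from the contour the Wiener-Hopf factors and their reciprocals are bounded. -/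
lemma exists_bound_cauchyExp (h₀ : 0 ≤ ω) (h₁ : ω < 1) (hc : |c| < sPlus ω) {d : ℝ} (hd : 0 < d) :
    ∃ C : ℝ, 0 < C ∧ ∀ s : ℂ, d ≤ |c - s.re| →
      ‖cauchyExp ω c s‖ ≤ C ∧ ‖(cauchyExp ω c s)⁻¹‖ ≤ C := by
  refine ⟨Real.exp (‖1 / (2 * (Real.pi : ℂ) * I)‖ *
    ((Real.pi / (1 - |c|) + Real.pi / d) / 2)), Real.exp_pos _, fun s hs => ?_⟩
  have hb : ‖1 / (2 * (Real.pi : ℂ) * I) * ∫ t : ℝ, contourIntegrand ω c s t‖ ≤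
      ‖1 / (2 * (Real.pi : ℂ) * I)‖ * ((Real.pi / (1 - |c|) + Real.pi / d) / 2) := by
    rw [norm_mul]
    gcongr
    exact norm_cauchy_integral_le (one_sub_abs_pos hc) (sq_norm_log_kappa_line_le h₀ h₁ hc) hd hs
  rw [cauchyExp, ← Complex.exp_neg]
  refine ⟨(norm_exp_le_exp_norm _).trans (Real.exp_le_exp.2 hb),
    (norm_exp_le_exp_norm _).trans (Real.exp_le_exp.2 ?_)⟩
  rwa [norm_neg]

lemma cauchyExp_neg (ω c : ℝ) (s : ℂ) : cauchyExp ω (-c) (-s) = (cauchyExp ω c s)⁻¹ := by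
  rw [cauchyExp, cauchyExp, ← Complex.exp_neg, ← mul_neg, ← integral_neg,
    ← integral_neg_eq_self (contourIntegrand ω (-c) (-s))]
  congr 3
  ext t
  have e : ((-c : ℝ) : ℂ) + I * ((-t : ℝ) : ℂ) = -((c : ℂ) + I * t) := by push_cast; ring
  have e2 : -((c : ℂ) + I * t) - -s = -((c : ℂ) + I * t - s) := by ring
  rw [contourIntegrand, contourIntegrand, e, kappa_neg, e2, div_neg, neg_mul]

end Factors

/-! ### The Cauchy formula on a strip -/

lemma tendsto_integral_inv_line {a : ℂ} (ha : 0 < a.re) :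
    Tendsto (fun T : ℝ => ∫ y in (-T)..T, I / (a + I * y)) atTop (𝓝 (Real.pi * I)) := by
  have hint : ∀ T : ℝ, ∫ y in (-T)..T, I / (a + I * y) = log (a + I * T) - log (a - I * T) := by
    intro T
    have hre : ∀ y : ℝ, 0 < (a + I * y).re := fun y => by simpa using ha
    have hd : ∀ y : ℝ, HasDerivAt (fun y : ℝ => log (a + I * y)) (I / (a + I * y)) y := by
      intro y
      have h := ((((hasDerivAt_id (y : ℂ)).const_mul I).const_add a).clog
        (Or.inl (hre y))).comp_ofReal
      simpa using h
    rw [intervalIntegral.integral_eq_sub_of_hasDerivAt (fun y _ => hd y)]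
    · push_cast; ring_nf
    · refine Continuous.intervalIntegrable ?_ _ _
      exact continuous_const.div (by fun_prop) fun y => ne_zero_of_re_pos (hre y)
  have hlim : Tendsto (fun T : ℝ => a / (T : ℂ)) atTop (𝓝 0) := by
    have : Tendsto (fun T : ℝ => ((T⁻¹ : ℝ) : ℂ)) atTop (𝓝 ((0 : ℝ) : ℂ)) :=
      (continuous_ofReal.tendsto 0).comp tendsto_inv_atTop_zero
    have := this.const_mul a
    simpa [div_eq_mul_inv] using this
  have h1 : Tendsto (fun T : ℝ => log (a / (T : ℂ) + I)) atTop (𝓝 (log I)) := by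
    have hc : ContinuousAt log I := continuousAt_clog (Or.inr (by simp))
    refine hc.tendsto.comp ?_
    simpa using hlim.add_const I
  have h2 : Tendsto (fun T : ℝ => log (a / (T : ℂ) - I)) atTop (𝓝 (log (-I))) := by
    have hc : ContinuousAt log (-I) := continuousAt_clog (Or.inr (by simp))
    refine hc.tendsto.comp ?_
    simpa using hlim.sub_const I
  have h3 := h1.sub h2
  rw [log_I, log_neg_I] at h3
  have e : (Real.pi : ℂ) / 2 * I - -(Real.pi / 2) * I = Real.pi * I := by ring
  rw [e] at h3
  refine h3.congr' ?_
  filter_upwards [eventually_gt_atTop 0] with T hT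
  have hT' : (T : ℂ) ≠ 0 := ofReal_ne_zero.2 hT.ne'
  have hre : 0 < (a / (T : ℂ)).re := by rw [div_ofReal_re]; positivity
  rw [hint, show a + I * T = (T : ℂ) * (a / T + I) by field_simp,
    show a - I * T = (T : ℂ) * (a / T - I) by field_simp,
    log_ofReal_mul hT (ne_zero_of_re_pos (by simpa using hre)),
    log_ofReal_mul hT (ne_zero_of_re_pos (by simpa using hre))]
  ring

lemma tendsto_dslope_horizontal {f : ℂ → ℂ} {b M : ℝ} {s : ℂ} (hM : ∀ z : ℂ, |z.re| ≤ b → ‖f z‖ ≤ M)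
    (hs : |s.re| ≤ b) {g : ℝ → ℝ} (hg : ∀ T, |g T| = |T|) :
    Tendsto (fun T : ℝ => ∫ x in (-b)..b, dslope f s ((x : ℂ) + (g T : ℂ) * I)) atTop (𝓝 0) := by
  have hb : 0 ≤ b := (abs_nonneg _).trans hs
  have hM0 : 0 ≤ M := (norm_nonneg _).trans (hM s hs)
  have hlim : Tendsto (fun T : ℝ => 2 * M / (T - |s.im|) * |b - -b|) atTop (𝓝 0) := by
    have : Tendsto (fun T : ℝ => T - |s.im|) atTop atTop :=
      tendsto_atTop_add_const_right _ _ tendsto_id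
    simpa using (this.const_div_atTop (2 * M)).mul_const _
  refine squeeze_zero_norm' ?_ hlim
  filter_upwards [eventually_gt_atTop |s.im|] with T hT
  have hTpos : 0 < T := (abs_nonneg _).trans_lt hT
  refine intervalIntegral.norm_integral_le_of_norm_le_const fun x hx => ?_
  rw [uIoc_of_le (by linarith)] at hx
  set z : ℂ := (x : ℂ) + (g T : ℂ) * I with hz
  have hzre : |z.re| ≤ b := by simp [hz, abs_le]; constructor <;> linarith [hx.1, hx.2]
  have him : T - |s.im| ≤ ‖z - s‖ := by
    refine le_trans ?_ (abs_im_le_norm _)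
    have : (z - s).im = g T - s.im := by simp [hz]
    rw [this]
    have := abs_sub_abs_le_abs_sub (g T) s.im
    rw [hg T, abs_of_pos hTpos] at this
    exact this
  have hpos : 0 < ‖z - s‖ := (sub_pos.2 hT).trans_le him
  rw [dslope_of_ne _ (sub_ne_zero.1 (norm_pos_iff.1 hpos)), slope_def_field, norm_div]
  have : ‖f z - f s‖ ≤ 2 * M := (norm_sub_le _ _).trans (by linarith [hM z hzre, hM s hs])
  have := sub_pos.2 hT
  gcongr

lemma cauchy_strip {f : ℂ → ℂ} {b b' M : ℝ} {s : ℂ} (hbb : b < b')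
    (hf : DifferentiableOn ℂ f {z | |z.re| < b'}) (hM : ∀ z : ℂ, |z.re| ≤ b → ‖f z‖ ≤ M)
    (hs : |s.re| < b)
    (hi₁ : Integrable fun t : ℝ => f ((b : ℂ) + I * t) / ((b : ℂ) + I * t - s) * I)
    (hi₂ : Integrable fun t : ℝ => f (((-b : ℝ) : ℂ) + I * t) / (((-b : ℝ) : ℂ) + I * t - s) * I) :
    (∫ t : ℝ, f ((b : ℂ) + I * t) / ((b : ℂ) + I * t - s) * I) -
      (∫ t : ℝ, f (((-b : ℝ) : ℂ) + I * t) / (((-b : ℝ) : ℂ) + I * t - s) * I) =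
      2 * Real.pi * I * f s := by
  have hsb := abs_lt.1 hs
  have hb : 0 < b := (abs_nonneg _).trans_lt hs
  have hopen : IsOpen {z : ℂ | |z.re| < b'} := isOpen_lt continuous_re.abs continuous_const
  have hq : DifferentiableOn ℂ (dslope f s) {z | |z.re| < b'} :=
    (differentiableOn_dslope (hopen.mem_nhds (hs.trans hbb))).2 hf
  have hline (c : ℝ) (hc : |c| = b) (T : ℝ) :
      I • ∫ y in (-T)..T, dslope f s ((c : ℂ) + (y : ℂ) * I) =
        (∫ y in (-T)..T, f ((c : ℂ) + I * y) / ((c : ℂ) + I * y - s) * I) -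
          f s * ∫ y in (-T)..T, I / ((c : ℂ) + I * y - s) := by
    have hcs : s.re ≠ c := by rintro h; rw [h] at hs; exact absurd hc hs.ne
    have hfc : Continuous fun y : ℝ => f ((c : ℂ) + I * y) := by
      refine continuous_iff_continuousAt.2 fun t => ?_
      have hm : (c : ℂ) + I * t ∈ {z : ℂ | |z.re| < b'} := by simpa [hc] using hbb
      exact (hf.differentiableAt (hopen.mem_nhds hm)).continuousAt.comp
        (f := fun t : ℝ => (c : ℂ) + I * t) (by fun_prop)
    rw [← intervalIntegral.integral_smul, ← intervalIntegral.integral_const_mul,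
      ← intervalIntegral.integral_sub]
    · refine intervalIntegral.integral_congr fun y _ => ?_
      have hne := line_sub_ne_zero hcs y
      simp only [smul_eq_mul]
      rw [mul_comm (y : ℂ) I, dslope_of_ne _ (sub_ne_zero.1 hne), slope_def_field]
      field_simp
    · exact ((hfc.div (by fun_prop) (line_sub_ne_zero hcs)).mul
        continuous_const).intervalIntegrable _ _
    · exact (continuous_const.mul (continuous_const.div (by fun_prop)
        (line_sub_ne_zero hcs))).intervalIntegrable _ _
  have hrect : ∀ T : ℝ, 0 =
      (∫ x in (-b)..b, dslope f s ((x : ℂ) + ((-T : ℝ) : ℂ) * I)) -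
        (∫ x in (-b)..b, dslope f s ((x : ℂ) + (T : ℂ) * I)) +
      ((∫ y in (-T)..T, f ((b : ℂ) + I * y) / ((b : ℂ) + I * y - s) * I) -
          f s * ∫ y in (-T)..T, I / ((b : ℂ) + I * y - s)) -
      ((∫ y in (-T)..T, f (((-b : ℝ) : ℂ) + I * y) / (((-b : ℝ) : ℂ) + I * y - s) * I) -
          f s * ∫ y in (-T)..T, I / (((-b : ℝ) : ℂ) + I * y - s)) := by
    intro T
    have h := integral_boundary_rect_eq_zero_of_differentiableOn (dslope f s)
      (((-b : ℝ) : ℂ) + ((-T : ℝ) : ℂ) * I) ((b : ℂ) + (T : ℂ) * I) (hq.mono (by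
        intro z hz
        have hz1 : z.re ∈ uIcc (-b) b := by simpa using hz.1
        rw [uIcc_of_le (by linarith)] at hz1
        exact (abs_le.2 hz1).trans_lt hbb))
    simp only [add_re, ofReal_re, mul_re, I_re, mul_zero, ofReal_im, I_im, mul_one, sub_self,
      add_zero, add_im, mul_im, zero_add] at h
    rw [hline b (abs_of_pos hb) T, hline (-b) (by rw [abs_neg, abs_of_pos hb]) T] at h
    exact h.symm
  have l1 := tendsto_dslope_horizontal hM hs.le (g := fun T => -T) (fun T => abs_neg T)
  have l2 := tendsto_dslope_horizontal hM hs.le (g := fun T => T) (fun T => rfl)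
  have l3 := intervalIntegral_tendsto_integral hi₁ tendsto_neg_atTop_atBot tendsto_id
  have l4 := intervalIntegral_tendsto_integral hi₂ tendsto_neg_atTop_atBot tendsto_id
  have l5 : Tendsto (fun T : ℝ => ∫ y in (-T)..T, I / ((b : ℂ) + I * y - s)) atTop
      (𝓝 (Real.pi * I)) := by
    refine (tendsto_integral_inv_line (a := (b : ℂ) - s) (by simp; linarith)).congr fun T => ?_
    refine intervalIntegral.integral_congr fun y _ => ?_
    congr 1; ring
  have l6 : Tendsto (fun T : ℝ => ∫ y in (-T)..T, I / (((-b : ℝ) : ℂ) + I * y - s)) atTop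
      (𝓝 (-(Real.pi * I))) := by
    refine (tendsto_integral_inv_line (a := (b : ℂ) + s) (by simp; linarith)).neg.congr fun T => ?_
    rw [← intervalIntegral.integral_neg]
    have := intervalIntegral.integral_comp_neg (a := -T) (b := T)
      (fun y : ℝ => I / (((-b : ℝ) : ℂ) + I * y - s))
    rw [neg_neg] at this
    rw [← this]
    refine intervalIntegral.integral_congr fun y _ => ?_
    rw [← div_neg]
    congr 1; push_cast; ring
  have hlim := (((l1.sub l2).add (l3.sub (l5.const_mul (f s)))).sub (l4.sub (l6.const_mul (f s))))
  have h0 := tendsto_nhds_unique hlim (tendsto_const_nhds.congr hrect)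
  linear_combination h0

lemma kappa_eq_div {ω β : ℝ} (h₀ : 0 ≤ ω) (h₁ : ω < 1) (hβ : β < sPlus ω) {s : ℂ}
    (hs : |s.re| < β) : kappa ω s = kappaPlus ω β s / kappaMinus ω β s := by
  have hb : 0 < β := (abs_nonneg _).trans_lt hs
  have hsb := abs_lt.1 hs
  have hβ' : |β| < sPlus ω := by rwa [abs_of_pos hb]
  have hβ'' : |-β| < sPlus ω := by rwa [abs_neg]
  have hc := cauchy_strip (f := fun z => log (kappa ω z)) (M := 1 / (1 - β)) hβ
    (fun z hz => (differentiableAt_log_kappa h₀ h₁ hz).differentiableWithinAt)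
    (fun z hz => by
      have hpos : 0 < 1 - β := by linarith [sPlus_le_one ω]
      refine abs_le_of_sq_le_sq' ?_ (by positivity) |>.2
      refine (sq_norm_log_kappa_le h₀ h₁ hβ hz).trans ?_
      rw [div_pow, one_pow]
      gcongr
      nlinarith [sq_nonneg z.im])
    hs (integrable_contourIntegrand h₀ h₁ hβ' hsb.2.ne)
    (integrable_contourIntegrand h₀ h₁ hβ'' hsb.1.ne')
  rw [kappaPlus, kappaMinus, cauchyExp, cauchyExp, ← Complex.exp_sub, ← mul_sub]
  have : (∫ t : ℝ, contourIntegrand ω β s t) - ∫ t : ℝ, contourIntegrand ω (-β) s t =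
    2 * Real.pi * I * log (kappa ω s) := hc
  rw [this, ← mul_assoc, one_div, inv_mul_cancel₀ two_pi_I_ne_zero, one_mul,
    exp_log (kappa_ne_zero h₀ h₁ (hs.trans hβ))]

/-! ### The angular integral -/

lemma integral_inv_one_sub_exp {r : ℂ} (hr : ‖r‖ < 1) :
    ∫ θ in (-Real.pi)..Real.pi, 1 / (1 - r * exp (I * θ)) = 2 * Real.pi := by
  have hne : ∀ z ∈ Metric.closedBall (0 : ℂ) |1|, 1 - r * z ≠ 0 := by
    intro z hz h
    have hz' : ‖z‖ ≤ 1 := by simpa using hz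
    have : ‖r * z‖ < 1 := by
      rw [norm_mul]; nlinarith [norm_nonneg r, norm_nonneg z]
    rw [← sub_eq_zero.1 h] at this
    simp at this
  have hd : DifferentiableOn ℂ (fun z => 1 / (1 - r * z)) (Metric.closedBall (0 : ℂ) |1|) :=
    fun z hz => (DifferentiableAt.fun_div (c := fun _ => (1 : ℂ)) (d := fun z => 1 - r * z)
      (by fun_prop) (by fun_prop) (hne z hz)).differentiableWithinAt
  have h := DiffContOnCl.circleAverage (f := fun z : ℂ => 1 / (1 - r * z)) (c := 0) (R := 1)
    (hd.diffContOnCl_ball subset_rfl)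
  rw [Real.circleAverage_def] at h
  have hp : Function.Periodic (fun θ : ℝ => 1 / (1 - r * circleMap 0 1 θ)) (2 * Real.pi) := by
    intro θ
    simp only [periodic_circleMap 0 1 θ]
  have hper := hp.intervalIntegral_add_eq 0 (-Real.pi)
  rw [zero_add, show -Real.pi + 2 * Real.pi = Real.pi by ring] at hper
  rw [hper] at h
  have h2 : (2 * Real.pi) • ((2 * Real.pi)⁻¹ •
      ∫ θ in (-Real.pi)..Real.pi, 1 / (1 - r * circleMap 0 1 θ)) =
      (2 * Real.pi) • (1 / (1 - r * 0)) := by rw [h]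
  rw [smul_smul, mul_inv_cancel₀ Real.two_pi_pos.ne', one_smul] at h2
  simpa [circleMap, mul_comm] using h2

lemma integral_angular {s : ℂ} (hs : |s.re| < 1) :
    (∫ θ in (-Real.pi)..Real.pi, 1 / (1 + s * (Real.cos θ : ℂ))) =
      2 * Real.pi / stripSqrt s := by
  set w := stripSqrt s with hw
  have hwre : 0 < w.re := stripSqrt_re_pos hs
  have hw0 : w ≠ 0 := stripSqrt_ne_zero hs
  have hsq : w ^ 2 = 1 - s ^ 2 := stripSqrt_sq s
  have hw1 : 1 + w ≠ 0 := ne_zero_of_re_pos (by simp; linarith)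
  set r := -s / (1 + w) with hr
  have hr2 : r ^ 2 = (1 - w) / (1 + w) := by
    rw [hr, div_pow, neg_sq, show s ^ 2 = (1 - w) * (1 + w) by linear_combination hsq]
    field_simp
  have hrn : ‖r‖ < 1 := by
    have h1 : ‖1 - w‖ < ‖1 + w‖ := by
      refine abs_lt_of_sq_lt_sq' ?_ (norm_nonneg _) |>.2
      rw [← normSq_eq_norm_sq, ← normSq_eq_norm_sq, normSq_apply, normSq_apply]
      simp; nlinarith
    have h2 : ‖r‖ ^ 2 < 1 := by
      rw [← norm_pow, hr2, norm_div, div_lt_one (norm_pos_iff.2 hw1)]; exact h1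
    exact (sq_lt_one_iff₀ (norm_nonneg _)).1 h2
  have hexp (θ : ℝ) : exp (I * θ) ≠ 0 := exp_ne_zero _
  have hn (x : ℝ) : 1 - r * exp (I * x) ≠ 0 := by
    intro h
    have h1 : ‖r * exp (I * x)‖ = 1 := by rw [← sub_eq_zero.1 h, norm_one]
    rw [norm_mul, mul_comm I, norm_exp_ofReal_mul_I, mul_one] at h1
    exact hrn.ne h1
  have hpt (θ : ℝ) : 1 / (1 + s * (Real.cos θ : ℂ)) =
      1 / w * (1 / (1 - r * exp (I * θ)) + 1 / (1 - r * exp (I * (-θ : ℝ))) - 1) := by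
    have h1 := hn θ
    have h2 := hn (-θ)
    have e : exp (I * ((-θ : ℝ) : ℂ)) = (exp (I * θ))⁻¹ := by
      rw [← Complex.exp_neg]; congr 1; push_cast; ring
    have hcos : (Real.cos θ : ℂ) = (exp (I * θ) + exp (I * ((-θ : ℝ) : ℂ))) / 2 := by
      rw [ofReal_cos, Complex.cos]; congr 2
      · rw [mul_comm]
      · congr 1; push_cast; ring
    set E := exp (I * θ) with hE
    set F := exp (I * ((-θ : ℝ) : ℂ)) with hF
    have hEF : E * F = 1 := by rw [e]; exact mul_inv_cancel₀ (hexp θ)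
    have hs' : s = -r * (1 + w) := by rw [hr]; field_simp
    have hr2' : r ^ 2 * (1 + w) = 1 - w := by rw [hr2]; field_simp
    have hprod : (1 - r * E) * (1 - r * F) * (1 + w) = 2 * (1 + s * (Real.cos θ : ℂ)) := by
      rw [hcos, hs']; linear_combination r ^ 2 * (1 + w) * hEF + hr2'
    have hden : 1 + s * (Real.cos θ : ℂ) ≠ 0 := by
      intro h
      rw [h, mul_zero] at hprod
      exact (mul_ne_zero (mul_ne_zero h1 h2) hw1) hprod
    have hsum : 1 / (1 - r * E) + 1 / (1 - r * F) - 1 =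
        (1 - r ^ 2) / ((1 - r * E) * (1 - r * F)) := by
      field_simp
      linear_combination (-r ^ 2) * hEF
    rw [hsum]
    have h12 := mul_ne_zero h1 h2
    field_simp
    have h3 : (1 - r ^ 2) * (1 + w) = 2 * w := by linear_combination -hr2'
    have h4 : (1 + w) * (w * ((1 - r * E) * (1 - r * F)) - (1 - r ^ 2) * (1 + s * (Real.cos θ : ℂ)))
        = 0 := by
      linear_combination w * hprod - (1 + s * (Real.cos θ : ℂ)) * h3
    have h5 := (mul_eq_zero.1 h4).resolve_left hw1
    linear_combination h5
  have hcont : Continuous fun θ : ℝ => 1 / (1 - r * exp (I * θ)) :=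
    continuous_const.div (by fun_prop) hn
  have hneg : ∫ θ in (-Real.pi)..Real.pi, 1 / (1 - r * exp (I * (-θ : ℝ))) = 2 * Real.pi := by
    rw [intervalIntegral.integral_comp_neg (fun θ : ℝ => 1 / (1 - r * exp (I * θ))), neg_neg,
      integral_inv_one_sub_exp hrn]
  simp_rw [hpt]
  rw [intervalIntegral.integral_const_mul, intervalIntegral.integral_sub,
    intervalIntegral.integral_add, hneg, integral_inv_one_sub_exp hrn]
  · simp; field_simp; ring
  · exact hcont.intervalIntegrable _ _
  · exact (hcont.comp continuous_neg).intervalIntegrable _ _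
  · exact (hcont.add (hcont.comp continuous_neg)).intervalIntegrable _ _
  · exact intervalIntegrable_const

/-! ### Entire continuation and Liouville -/

/-- Two functions analytic in overlapping half-planes, which agree in the common strip, grow at most
linearly, and are `o(|s|)` along the positive real axis, are both equal to one constant. -/
lemma exists_const_of_overlap {f g : ℂ → ℂ} {b m C₁ C₂ : ℝ} (hm : 0 < m) (hmb : m < b)
    (hf : ∀ s : ℂ, 0 < s.re → DifferentiableAt ℂ f s)
    (hg : ∀ s : ℂ, s.re < b → DifferentiableAt ℂ g s)
    (hfg : ∀ s : ℂ, 0 < s.re → s.re < b → f s = g s)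
    (hfC : ∀ s : ℂ, m ≤ s.re → ‖f s‖ ≤ C₁ * (1 + ‖s‖))
    (hgC : ∀ s : ℂ, s.re ≤ m → ‖g s‖ ≤ C₂ * (1 + ‖s‖))
    (hlim : Tendsto (fun x : ℝ => f x / x) atTop (𝓝 0)) :
    ∃ J : ℂ, (∀ s : ℂ, 0 < s.re → f s = J) ∧ ∀ s : ℂ, s.re < b → g s = J := by
  classical
  set h : ℂ → ℂ := fun s => if s.re < b then g s else f s with hh
  have h_g : ∀ s : ℂ, s.re < b → h s = g s := fun s hs => if_pos hs
  have h_f : ∀ s : ℂ, 0 < s.re → h s = f s := by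
    intro s hs
    by_cases hb : s.re < b
    · rw [h_g s hb, hfg s hs hb]
    · exact if_neg hb
  have hdiff : Differentiable ℂ h := by
    intro s
    by_cases hb : s.re < b
    · refine (hg s hb).congr_of_eventuallyEq ?_
      filter_upwards [(isOpen_lt continuous_re continuous_const).mem_nhds hb] with z hz
        using h_g z hz
    · have hs : 0 < s.re := by linarith [not_lt.1 hb]
      refine (hf s hs).congr_of_eventuallyEq ?_
      filter_upwards [(isOpen_lt continuous_const continuous_re).mem_nhds hs] with z hz
        using h_f z hz
  set C := max (max C₁ C₂) 0 with hC
  have hC0 : 0 ≤ C := le_max_right _ _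
  have hbound : ∀ s, ‖h s‖ ≤ C * (1 + ‖s‖) := by
    intro s
    rcases le_total m s.re with hs | hs
    · rw [h_f s (hm.trans_le hs)]
      exact (hfC s hs).trans (by gcongr; exact (le_max_left _ _).trans (le_max_left _ _))
    · rw [h_g s (hs.trans_lt hmb)]
      exact (hgC s hs).trans (by gcongr; exact (le_max_right _ _).trans (le_max_left _ _))
  have hq : Differentiable ℂ (dslope h 0) := by
    rw [← differentiableOn_univ]
    exact (differentiableOn_dslope univ_mem).2 hdiff.differentiableOn
  have hqb : Bornology.IsBounded (range (dslope h 0)) := by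
    obtain ⟨B, hB⟩ := ((isCompact_closedBall (0 : ℂ) 1).image hq.continuous).isBounded.exists_norm_le
    refine isBounded_iff_forall_norm_le.2 ⟨max B (3 * C), ?_⟩
    rintro _ ⟨s, rfl⟩
    by_cases hs : ‖s‖ ≤ 1
    · exact (hB _ ⟨s, by simpa using hs, rfl⟩).trans (le_max_left _ _)
    · have hs1 : 1 < ‖s‖ := not_le.1 hs
      have hs0 : s ≠ 0 := norm_pos_iff.1 (by linarith)
      refine le_trans ?_ (le_max_right _ _)
      rw [dslope_of_ne _ hs0, slope_def_field, sub_zero, norm_div, div_le_iff₀ (by linarith)]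
      have h1 := hbound s
      have h2 := hbound 0
      rw [norm_zero, add_zero, mul_one] at h2
      have h3 := norm_sub_le (h s) (h 0)
      nlinarith
  have hconst : ∀ s, dslope h 0 s = dslope h 0 0 := fun s => hq.apply_eq_apply_of_bounded hqb s 0
  have hzero : dslope h 0 0 = 0 := by
    have hl0 : Tendsto (fun x : ℝ => h 0 / (x : ℂ)) atTop (𝓝 0) := by
      have : Tendsto (fun x : ℝ => ((x⁻¹ : ℝ) : ℂ)) atTop (𝓝 ((0 : ℝ) : ℂ)) :=
        (continuous_ofReal.tendsto 0).comp tendsto_inv_atTop_zero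
      simpa [div_eq_mul_inv] using this.const_mul (h 0)
    have hl := hlim.sub hl0
    rw [sub_zero] at hl
    refine tendsto_nhds_unique (tendsto_const_nhds (f := atTop (α := ℝ))) (hl.congr' ?_)
    filter_upwards [eventually_gt_atTop 0] with x hx
    have hx' : (x : ℂ) ≠ 0 := ofReal_ne_zero.2 hx.ne'
    rw [← hconst x, dslope_of_ne _ hx', slope_def_field, sub_zero, h_f x (by simpa using hx), sub_div]
  have hJ : ∀ s, h s = h 0 := by
    intro s
    by_cases hs : s = 0
    · rw [hs]
    · have := hconst s
      rw [hzero, dslope_of_ne _ hs, slope_def_field, sub_zero, div_eq_zero_iff] at this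
      exact sub_eq_zero.1 (this.resolve_right hs)
  exact ⟨h 0, fun s hs => by rw [← h_f s hs, hJ], fun s hs => by rw [← h_g s hs, hJ]⟩

/-! ### One-sided Laplace transforms -/

lemma integrable_cexp_mul_of_re {α : Type*} [MeasurableSpace α] {ν : Measure α} {g f : α → ℝ}
    (hg : Measurable g) {s : ℂ} (h : Integrable (fun x => Real.exp (-s.re * g x) * f x) ν) :
    Integrable (fun x => exp (-s * (g x : ℂ)) * (f x : ℂ)) ν := by
  have hm : Measurable fun x => exp (-(s.im * g x : ℝ) * I) := by fun_prop
  have := h.ofReal (𝕜 := ℂ).bdd_mul (c := 1) hm.aestronglyMeasurable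
    (ae_of_all _ fun x => by
      rw [← ofReal_neg, norm_exp_ofReal_mul_I])
  refine this.congr (ae_of_all _ fun x => ?_)
  simp only [coe_algebraMap]
  push_cast
  rw [← mul_assoc, ← Complex.exp_add]
  congr 2
  conv_rhs => rw [← re_add_im s]
  ring

lemma norm_cexp_mul_ofReal (s : ℂ) (x y : ℝ) :
    ‖exp (-s * (x : ℂ)) * (y : ℂ)‖ = ‖Real.exp (-s.re * x) * y‖ := by
  rw [norm_mul, norm_mul, norm_exp, norm_real, Real.norm_eq_abs (Real.exp _), Real.abs_exp]
  simp

section Laplace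

variable {f : ℝ → ℝ}

lemma laplace_integrable (hf : ∀ σ : ℝ, 0 < σ → IntegrableOn (fun τ => Real.exp (-σ * τ) * f τ) (Ioi 0))
    {s : ℂ} (hs : 0 < s.re) :
    IntegrableOn (fun τ : ℝ => exp (-s * (τ : ℂ)) * (f τ : ℂ)) (Ioi 0) :=
  integrable_cexp_mul_of_re measurable_id (hf s.re hs)

lemma norm_laplace_integrand_le {m : ℝ} {s : ℂ} (hs : m ≤ s.re) {τ : ℝ} (hτ : τ ∈ Ioi (0 : ℝ)) :
    ‖exp (-s * (τ : ℂ)) * (f τ : ℂ)‖ ≤ ‖Real.exp (-m * τ) * f τ‖ := by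
  rw [norm_cexp_mul_ofReal]
  simp only [norm_mul, Real.norm_eq_abs, Real.abs_exp]
  have : 0 < τ := hτ
  gcongr

lemma exists_bound_laplace
    (hf : ∀ σ : ℝ, 0 < σ → IntegrableOn (fun τ => Real.exp (-σ * τ) * f τ) (Ioi 0)) {m : ℝ}
    (hm : 0 < m) : ∃ C : ℝ, 0 ≤ C ∧ ∀ s : ℂ, m ≤ s.re → ‖laplace f s‖ ≤ C := by
  refine ⟨∫ τ in Ioi (0 : ℝ), ‖Real.exp (-m * τ) * f τ‖,
    integral_nonneg fun _ => norm_nonneg _, fun s hs => ?_⟩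
  refine norm_integral_le_of_norm_le (hf m hm).norm ?_
  filter_upwards [ae_restrict_mem measurableSet_Ioi] with τ hτ
  exact norm_laplace_integrand_le hs hτ

lemma tendsto_laplace_zero
    (hf : ∀ σ : ℝ, 0 < σ → IntegrableOn (fun τ => Real.exp (-σ * τ) * f τ) (Ioi 0)) :
    Tendsto (fun x : ℝ => laplace f x) atTop (𝓝 0) := by
  have h := tendsto_integral_filter_of_dominated_convergence (μ := volume.restrict (Ioi (0 : ℝ)))
    (l := atTop) (F := fun (x τ : ℝ) => exp (-(x : ℂ) * (τ : ℂ)) * (f τ : ℂ)) (f := fun _ => (0 : ℂ))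
    (fun τ => ‖Real.exp (-1 * τ) * f τ‖)
    (by
      filter_upwards [eventually_gt_atTop 0] with x hx
      exact (laplace_integrable hf (s := x) (by simpa using hx)).aestronglyMeasurable)
    (by
      filter_upwards [eventually_ge_atTop 1] with x hx
      filter_upwards [ae_restrict_mem measurableSet_Ioi] with τ hτ
      exact norm_laplace_integrand_le (by simpa using hx) hτ)
    (hf 1 one_pos).norm
    (by
      filter_upwards [ae_restrict_mem measurableSet_Ioi] with τ hτ
      have h1 : Tendsto (fun x : ℝ => Real.exp (-(x * τ))) atTop (𝓝 0) :=
        Real.tendsto_exp_neg_atTop_nhds_zero.comp (tendsto_id.atTop_mul_const hτ)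
      have h2 := ((continuous_ofReal.tendsto 0).comp h1).mul_const (f τ : ℂ)
      rw [ofReal_zero, zero_mul] at h2
      refine h2.congr fun x => ?_
      simp)
  simpa [laplace] using h

lemma differentiableAt_laplace
    (hf : ∀ σ : ℝ, 0 < σ → IntegrableOn (fun τ => Real.exp (-σ * τ) * f τ) (Ioi 0)) {s : ℂ}
    (hs : 0 < s.re) : DifferentiableAt ℂ (laplace f) s := by
  set σ := s.re / 2 with hσ
  have hσ0 : 0 < σ := half_pos hs
  have hopen : IsOpen {z : ℂ | σ < z.re} := isOpen_lt continuous_const continuous_re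
  have hsσ : s ∈ {z : ℂ | σ < z.re} := show σ < s.re by linarith
  have key := hasDerivAt_integral_of_dominated_loc_of_deriv_le (𝕜 := ℂ)
    (μ := volume.restrict (Ioi (0 : ℝ)))
    (F := fun z (τ : ℝ) => exp (-z * (τ : ℂ)) * (f τ : ℂ))
    (F' := fun z (τ : ℝ) => (-(τ : ℂ)) * (exp (-z * (τ : ℂ)) * (f τ : ℂ)))
    (bound := fun τ => 2 / σ * ‖Real.exp (-(σ / 2) * τ) * f τ‖)
    (hopen.mem_nhds hsσ)
    (by
      filter_upwards [hopen.mem_nhds hsσ] with z hz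
      exact (laplace_integrable hf (hσ0.trans hz)).aestronglyMeasurable)
    (laplace_integrable hf hs)
    ((by fun_prop : Continuous fun τ : ℝ => -(τ : ℂ)).aestronglyMeasurable.mul
      (laplace_integrable hf hs).aestronglyMeasurable)
    (by
      filter_upwards [ae_restrict_mem measurableSet_Ioi] with τ hτ z hz
      have hτ0 : 0 < τ := hτ
      have h1 := norm_laplace_integrand_le (f := f) (le_of_lt hz) hτ
      have h2 : τ ≤ 2 / σ * Real.exp (σ / 2 * τ) := by
        have := Real.add_one_le_exp (σ / 2 * τ)
        calc τ = 2 / σ * (σ / 2 * τ) := by field_simp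
          _ ≤ 2 / σ * Real.exp (σ / 2 * τ) := by gcongr; linarith
      rw [norm_mul, norm_neg, norm_real, Real.norm_eq_abs, abs_of_pos hτ0]
      calc τ * ‖exp (-z * (τ : ℂ)) * (f τ : ℂ)‖
          ≤ (2 / σ * Real.exp (σ / 2 * τ)) * ‖Real.exp (-σ * τ) * f τ‖ := by gcongr
        _ = 2 / σ * ‖Real.exp (-(σ / 2) * τ) * f τ‖ := by
          rw [norm_mul, norm_mul, Real.norm_eq_abs, Real.norm_eq_abs (Real.exp (-(σ / 2) * τ)),
            Real.abs_exp, Real.abs_exp,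
            show -(σ / 2) * τ = σ / 2 * τ + -σ * τ by ring, Real.exp_add]
          ring)
    ((hf (σ / 2) (half_pos hσ0)).norm.const_mul _)
    (ae_of_all _ fun τ z _ => by
      have h := ((((hasDerivAt_id z).neg.mul_const (τ : ℂ)).cexp).mul_const (f τ : ℂ))
      convert! h using 1
      simp; ring)
  exact key.2.differentiableAt

end Laplace

/-! ### The transport equation in the Laplace domain -/

namespace IsDiffuseFlux

variable {ω θ₀ : ℝ} {ψ : ℝ → ℝ → ℝ}

lemma integrable_joint (hψ : IsDiffuseFlux ω θ₀ ψ) {s : ℂ} (hs : 0 < s.re) :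
    Integrable (fun p : ℝ × ℝ => exp (-s * (p.2 : ℂ)) * (ψ p.1 p.2 : ℂ))
      ((volume.restrict (Ioo (-Real.pi) Real.pi)).prod (volume.restrict (Ioi (0 : ℝ)))) := by
  have h := hψ.laplace_joint s.re hs
  rw [IntegrableOn, Measure.volume_eq_prod, ← Measure.prod_restrict] at h
  exact integrable_cexp_mul_of_re measurable_snd h

lemma photonDensity_eq (ψ : ℝ → ℝ → ℝ) (τ : ℝ) :
    photonDensity ψ τ = ∫ θ in Ioo (-Real.pi) Real.pi, ψ θ τ := by
  rw [photonDensity, intervalIntegral.integral_of_le (by linarith [Real.pi_pos]),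
    integral_Ioc_eq_integral_Ioo]

lemma laplace_density (hψ : IsDiffuseFlux ω θ₀ ψ) (σ : ℝ) (hσ : 0 < σ) :
    IntegrableOn (fun τ => Real.exp (-σ * τ) * photonDensity ψ τ) (Ioi 0) := by
  have h := hψ.laplace_joint σ hσ
  rw [IntegrableOn, Measure.volume_eq_prod, ← Measure.prod_restrict] at h
  refine h.integral_prod_right.congr (ae_of_all _ fun τ => ?_)
  simp only
  rw [integral_const_mul, photonDensity_eq]

lemma integrable_laplace_angle (hψ : IsDiffuseFlux ω θ₀ ψ) {s : ℂ} (hs : 0 < s.re) :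
    IntegrableOn (fun θ => laplace (ψ θ) s) (Ioo (-Real.pi) Real.pi) :=
  (hψ.integrable_joint hs).integral_prod_left

lemma laplace_density_eq (hψ : IsDiffuseFlux ω θ₀ ψ) {s : ℂ} (hs : 0 < s.re) :
    laplace (photonDensity ψ) s = ∫ θ in Ioo (-Real.pi) Real.pi, laplace (ψ θ) s := by
  have h := integral_integral_swap (f := fun θ (τ : ℝ) => exp (-s * (τ : ℂ)) * (ψ θ τ : ℂ))
    (hψ.integrable_joint hs)
  simp only [laplace]
  rw [h]
  refine integral_congr_ae (ae_of_all _ fun τ => ?_)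
  simp only
  rw [integral_const_mul, photonDensity_eq, integral_complex_ofReal]

/-- The Laplace transform of the total source, divided by `ω / 2π`. -/
noncomputable def source (ψ : ℝ → ℝ → ℝ) (μ₀ : ℝ) (s : ℂ) : ℂ :=
  laplace (photonDensity ψ) s + (μ₀ : ℂ) / (1 + μ₀ * s)

lemma one_add_mul_ne_zero {μ₀ : ℝ} (hμ : 0 < μ₀) {s : ℂ} (hs : 0 < s.re) : 1 + (μ₀ : ℂ) * s ≠ 0 :=
  ne_zero_of_re_pos (by
    have : 0 < μ₀ * s.re := mul_pos hμ hs
    simp; linarith)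

lemma integrable_integral_exp_source {μ₀ : ℝ} (hμ : 0 < μ₀) {s : ℂ} (hs : 0 < s.re) :
    IntegrableOn (fun τ : ℝ => exp (-s * (τ : ℂ)) * (Real.exp (-τ / μ₀) : ℂ)) (Ioi 0) ∧
    ∫ τ in Ioi (0 : ℝ), exp (-s * (τ : ℂ)) * (Real.exp (-τ / μ₀) : ℂ) = (μ₀ : ℂ) / (1 + μ₀ * s) := by
  have e : (fun τ : ℝ => exp (-s * (τ : ℂ)) * (Real.exp (-τ / μ₀) : ℂ)) =
      fun τ : ℝ => exp (-(s + 1 / μ₀) * (τ : ℂ)) := by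
    ext τ
    rw [ofReal_exp, ← Complex.exp_add]; congr 1; push_cast; ring
  have hre : (-(s + 1 / (μ₀ : ℂ))).re < 0 := by
    have e2 : (1 / (μ₀ : ℂ)) = ((1 / μ₀ : ℝ) : ℂ) := by push_cast; rfl
    rw [e2, neg_re, add_re, ofReal_re]
    have : 0 < 1 / μ₀ := by positivity
    linarith
  have hμ' : (μ₀ : ℂ) ≠ 0 := ofReal_ne_zero.2 hμ.ne'
  have h1 := one_add_mul_ne_zero hμ hs
  have h2 : s + 1 / (μ₀ : ℂ) ≠ 0 := by
    intro h; rw [h] at hre; simp at hre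
  rw [e]
  refine ⟨integrableOn_exp_mul_complex_Ioi hre 0, ?_⟩
  rw [integral_exp_mul_complex_Ioi hre 0, ofReal_zero, mul_zero, Complex.exp_zero, neg_div_neg_eq,
    one_div]
  rw [show s + 1 / (μ₀ : ℂ) = (1 + μ₀ * s) / μ₀ by field_simp; ring, inv_div]

lemma laplace_transport (hψ : IsDiffuseFlux ω θ₀ ψ) (hμ : 0 < Real.cos θ₀) {s : ℂ} (hs : 0 < s.re)
    {θ : ℝ} (hθ : θ ∈ Ioo (-Real.pi) Real.pi) (hcos : Real.cos θ ≠ 0) :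
    (1 + s * (Real.cos θ : ℂ)) * laplace (ψ θ) s =
      (Real.cos θ : ℂ) * (ψ θ 0 : ℂ) + ω / (2 * Real.pi) * source ψ (Real.cos θ₀) s := by
  obtain ⟨i3, v3⟩ := integrable_integral_exp_source hμ hs
  have i1 := laplace_integrable (hψ.laplace_angle θ hθ hcos) hs
  have i2 := laplace_integrable hψ.laplace_density hs
  have hder : ∀ τ ∈ Ioi (0 : ℝ), HasDerivAt
      (fun τ : ℝ => (Real.cos θ : ℂ) * (exp (-s * (τ : ℂ)) * (ψ θ τ : ℂ)))
      (-(1 + s * (Real.cos θ : ℂ)) * (exp (-s * (τ : ℂ)) * (ψ θ τ : ℂ)) +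
        (ω / (2 * Real.pi) * (exp (-s * (τ : ℂ)) * (photonDensity ψ τ : ℂ)) +
        ω / (2 * Real.pi) * (exp (-s * (τ : ℂ)) * (Real.exp (-τ / Real.cos θ₀) : ℂ)))) τ := by
    intro τ hτ
    have h1 := (hψ.differentiable θ hθ hcos τ hτ).hasDerivAt.ofReal_comp
    have h2 : HasDerivAt (fun τ : ℝ => exp (-s * (τ : ℂ))) (exp (-s * (τ : ℂ)) * -s) τ := by
      have := (((hasDerivAt_id (τ : ℂ)).const_mul (-s)).cexp).comp_ofReal
      simpa using this
    have h3 := (h2.mul h1).const_mul (Real.cos θ : ℂ)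
    have ht : (Real.cos θ : ℂ) * ((deriv (ψ θ) τ : ℝ) : ℂ) + (ψ θ τ : ℂ) =
        ω / (2 * Real.pi) * (photonDensity ψ τ : ℂ) +
          ω / (2 * Real.pi) * (Real.exp (-τ / Real.cos θ₀) : ℂ) := by
      exact_mod_cast hψ.transport θ hθ hcos τ hτ
    refine h3.congr_deriv ?_
    linear_combination exp (-s * (τ : ℂ)) * ht
  have i23 : IntegrableOn (fun τ : ℝ =>
      ω / (2 * Real.pi) * (exp (-s * (τ : ℂ)) * (photonDensity ψ τ : ℂ)) +
        ω / (2 * Real.pi) * (exp (-s * (τ : ℂ)) * (Real.exp (-τ / Real.cos θ₀) : ℂ))) (Ioi 0) :=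
    (i2.const_mul _).add (i3.const_mul _)
  have iI := (i1.const_mul (-(1 + s * (Real.cos θ : ℂ)))).add i23
  have hlim := tendsto_zero_of_hasDerivAt_of_integrableOn_Ioi hder iI
    (i1.const_mul (Real.cos θ : ℂ))
  have hcont : ContinuousWithinAt
      (fun τ : ℝ => (Real.cos θ : ℂ) * (exp (-s * (τ : ℂ)) * (ψ θ τ : ℂ))) (Ici 0) 0 := by
    have h1 := continuous_ofReal.continuousAt.comp_continuousWithinAt
      (hψ.continuous_boundary θ hθ hcos)
    have h2 : ContinuousWithinAt (fun τ : ℝ => exp (-s * (τ : ℂ))) (Ici 0) 0 := by fun_prop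
    exact (h2.mul h1).const_mul _
  have h := integral_Ioi_of_hasDerivAt_of_tendsto hcont hder iI hlim
  rw [integral_add (i1.const_mul _) i23,
    integral_add (i2.const_mul _) (i3.const_mul _), integral_const_mul, integral_const_mul,
    integral_const_mul, v3] at h
  simp only [ofReal_zero, mul_zero, Complex.exp_zero, one_mul] at h
  rw [source, laplace, laplace]
  linear_combination -h

lemma ae_cos_ne_zero : ∀ᵐ θ : ℝ, Real.cos θ ≠ 0 := by
  have : {θ : ℝ | Real.cos θ = 0}.Countable := by
    refine (countable_range fun k : ℤ => (2 * (k : ℝ) + 1) * Real.pi / 2).mono fun θ hθ => ?_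
    obtain ⟨k, hk⟩ := Real.cos_eq_zero_iff.1 hθ
    exact ⟨k, hk.symm⟩
  simpa [ae_iff] using this.measure_zero volume

lemma ae_angle {p : ℝ → Prop}
    (h : ∀ θ ∈ Ioo (-Real.pi) Real.pi, Real.cos θ ≠ 0 → p θ) :
    ∀ᵐ θ ∂volume.restrict (Ioo (-Real.pi) Real.pi), p θ := by
  filter_upwards [ae_restrict_mem measurableSet_Ioo, ae_restrict_of_ae ae_cos_ne_zero] with θ h1 h2
    using h θ h1 h2

/-- Only the outward directions carry boundary flux. -/
lemma cos_neg_or_boundary_eq_zero (hψ : IsDiffuseFlux ω θ₀ ψ) {θ : ℝ}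
    (hθ : θ ∈ Ioo (-Real.pi) Real.pi) : Real.cos θ < 0 ∨ Real.cos θ * ψ θ 0 = 0 := by
  rcases lt_trichotomy (Real.cos θ) 0 with h | h | h
  · exact Or.inl h
  · right; rw [h, zero_mul]
  · right
    rw [hψ.no_reentrant θ, mul_zero]
    by_contra hcon
    have hle : |θ| ≤ Real.pi + Real.pi / 2 := by
      linarith [(abs_lt.2 hθ), Real.pi_pos]
    have := Real.cos_nonpos_of_pi_div_two_le_of_le (not_lt.1 hcon) hle
    rw [Real.cos_abs] at this
    linarith

lemma integrable_boundary (hψ : IsDiffuseFlux ω θ₀ ψ) (hμ : 0 < Real.cos θ₀) :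
    IntegrableOn (fun θ => (Real.cos θ : ℂ) * (ψ θ 0 : ℂ)) (Ioo (-Real.pi) Real.pi) := by
  have h1 : (0 : ℝ) < (1 : ℂ).re := by simp
  have hint : IntegrableOn (fun θ => (1 + 1 * (Real.cos θ : ℂ)) * laplace (ψ θ) 1 -
      ω / (2 * Real.pi) * source ψ (Real.cos θ₀) 1) (Ioo (-Real.pi) Real.pi) := by
    refine Integrable.sub ?_ (integrable_const _)
    refine (hψ.integrable_laplace_angle h1).bdd_mul (c := 2)
      (by fun_prop : Continuous fun θ : ℝ => 1 + 1 * (Real.cos θ : ℂ)).aestronglyMeasurable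
      (ae_of_all _ fun θ => ?_)
    refine (norm_add_le _ _).trans ?_
    rw [norm_mul, norm_one, one_mul, norm_real]
    linarith [Real.abs_cos_le_one θ, (Real.norm_eq_abs (Real.cos θ)).le]
  refine hint.congr (ae_angle fun θ hθ hcos => ?_)
  simp only
  rw [hψ.laplace_transport hμ h1 hθ hcos]; ring

/-- The contribution of the boundary flux to the Laplace-transformed density. -/
noncomputable def boundaryTerm (ψ : ℝ → ℝ → ℝ) (s : ℂ) : ℂ :=
  ∫ θ in Ioo (-Real.pi) Real.pi, (Real.cos θ : ℂ) * (ψ θ 0 : ℂ) / (1 + s * (Real.cos θ : ℂ))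

lemma one_sub_le_norm {m : ℝ} (hm : 0 ≤ m) {s : ℂ} (hs : s.re ≤ m) {c : ℝ} (hc : c ≤ 0)
    (hc1 : -1 ≤ c) : 1 - m ≤ ‖1 + s * (c : ℂ)‖ := by
  refine le_trans ?_ (re_le_norm _)
  simp only [add_re, one_re, re_mul_ofReal]
  nlinarith

lemma norm_boundaryTerm_le (hψ : IsDiffuseFlux ω θ₀ ψ) (hμ : 0 < Real.cos θ₀) {m : ℝ} (hm : 0 ≤ m)
    (hm1 : m < 1) {s : ℂ} (hs : s.re ≤ m) :
    ‖boundaryTerm ψ s‖ ≤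
      (∫ θ in Ioo (-Real.pi) Real.pi, ‖(Real.cos θ : ℂ) * (ψ θ 0 : ℂ)‖) / (1 - m) := by
  rw [← integral_div]
  refine norm_integral_le_of_norm_le ((hψ.integrable_boundary hμ).norm.div_const _) ?_
  filter_upwards [ae_restrict_mem measurableSet_Ioo] with θ hθ
  have hm' := sub_pos.2 hm1
  rw [norm_div]
  rcases hψ.cos_neg_or_boundary_eq_zero hθ with h | h
  · have := one_sub_le_norm hm hs h.le (Real.neg_one_le_cos θ)
    gcongr
  · have : (Real.cos θ : ℂ) * (ψ θ 0 : ℂ) = 0 := by exact_mod_cast h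
    rw [this]; simp

lemma differentiableAt_boundaryTerm (hψ : IsDiffuseFlux ω θ₀ ψ) (hμ : 0 < Real.cos θ₀) {s : ℂ}
    (hs : s.re < 1) : DifferentiableAt ℂ (boundaryTerm ψ) s := by
  obtain ⟨m, hm, hm1⟩ : ∃ m, max s.re 0 < m ∧ m < 1 := exists_between (max_lt hs one_pos)
  have hm0 : 0 ≤ m := (le_max_right _ _).trans hm.le
  have hsm : s.re < m := (le_max_left _ _).trans_lt hm
  have hm' := sub_pos.2 hm1
  have hopen : IsOpen {z : ℂ | z.re < m} := isOpen_lt continuous_re continuous_const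
  have hi := hψ.integrable_boundary hμ
  have hmeas (n : ℕ) (z : ℂ) : AEStronglyMeasurable (fun θ : ℝ =>
      (Real.cos θ : ℂ) * (ψ θ 0 : ℂ) / (1 + z * (Real.cos θ : ℂ)) ^ n)
      (volume.restrict (Ioo (-Real.pi) Real.pi)) := by
    refine (hi.aestronglyMeasurable.mul (g := fun θ : ℝ => ((1 + z * (Real.cos θ : ℂ)) ^ n)⁻¹) ?_)
    exact (Measurable.inv (by fun_prop)).aestronglyMeasurable
  have hzero {θ : ℝ} (h : Real.cos θ * ψ θ 0 = 0) : (Real.cos θ : ℂ) * (ψ θ 0 : ℂ) = 0 := by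
    exact_mod_cast h
  have key := hasDerivAt_integral_of_dominated_loc_of_deriv_le (𝕜 := ℂ)
    (μ := volume.restrict (Ioo (-Real.pi) Real.pi))
    (F := fun z (θ : ℝ) => (Real.cos θ : ℂ) * (ψ θ 0 : ℂ) / (1 + z * (Real.cos θ : ℂ)))
    (F' := fun z (θ : ℝ) => -(Real.cos θ : ℂ) *
      ((Real.cos θ : ℂ) * (ψ θ 0 : ℂ) / (1 + z * (Real.cos θ : ℂ)) ^ 2))
    (bound := fun θ => ‖(Real.cos θ : ℂ) * (ψ θ 0 : ℂ)‖ / (1 - m) ^ 2)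
    (hopen.mem_nhds hsm)
    (Eventually.of_forall fun z => by simpa using hmeas 1 z)
    (by
      refine (hi.norm.div_const (1 - m)).mono' (by simpa using hmeas 1 s) ?_
      filter_upwards [ae_restrict_mem measurableSet_Ioo] with θ hθ
      rw [norm_div]
      rcases hψ.cos_neg_or_boundary_eq_zero hθ with h | h
      · have := one_sub_le_norm hm0 hsm.le h.le (Real.neg_one_le_cos θ)
        gcongr
      · rw [hzero h]; simp)
    ((by fun_prop : Continuous fun θ : ℝ => -(Real.cos θ : ℂ)).aestronglyMeasurable.mul (hmeas 2 s))
    (by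
      filter_upwards [ae_restrict_mem measurableSet_Ioo] with θ hθ z hz
      rcases hψ.cos_neg_or_boundary_eq_zero hθ with h | h
      · have h1 := one_sub_le_norm hm0 (le_of_lt hz) h.le (Real.neg_one_le_cos θ)
        have h2 : ‖(-(Real.cos θ : ℂ))‖ ≤ 1 := by
          rw [norm_neg, norm_real]; exact Real.abs_cos_le_one θ
        rw [norm_mul, norm_div, norm_pow]
        refine (mul_le_of_le_one_left (by positivity) h2).trans ?_
        gcongr
      · rw [hzero h]; simp)
    (hi.norm.div_const _)
    (by
      filter_upwards [ae_restrict_mem measurableSet_Ioo] with θ hθ z hz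
      rcases hψ.cos_neg_or_boundary_eq_zero hθ with h | h
      · have h1 := one_sub_le_norm hm0 (le_of_lt hz) h.le (Real.neg_one_le_cos θ)
        have h2 : 1 + z * (Real.cos θ : ℂ) ≠ 0 := norm_pos_iff.1 (hm'.trans_le h1)
        have h3 := (hasDerivAt_const z ((Real.cos θ : ℂ) * (ψ θ 0 : ℂ))).div
          (((hasDerivAt_id z).mul_const (Real.cos θ : ℂ)).const_add 1) h2
        convert! h3 using 1
        simp; ring
      · rw [hzero h]
        simpa using hasDerivAt_const z (0 : ℂ))
  exact key.2.differentiableAt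

/-- The Wiener-Hopf equation, valid in the strip `0 < Re s < 1`. -/
lemma wienerHopf (hψ : IsDiffuseFlux ω θ₀ ψ) (hμ : 0 < Real.cos θ₀) {s : ℂ} (hs : 0 < s.re)
    (hs1 : s.re < 1) :
    source ψ (Real.cos θ₀) s * (1 - (ω : ℂ) / stripSqrt s) =
      (Real.cos θ₀ : ℂ) / (1 + (Real.cos θ₀ : ℂ) * s) + boundaryTerm ψ s := by
  have habs : |s.re| < 1 := by rwa [abs_of_pos hs]
  have hne : ∀ θ : ℝ, 1 + s * (Real.cos θ : ℂ) ≠ 0 := fun θ => ne_zero_of_re_pos (by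
    have h1 := Real.neg_one_le_cos θ
    simp only [add_re, one_re, re_mul_ofReal]
    nlinarith)
  have hcont : Continuous fun θ : ℝ => 1 / (1 + s * (Real.cos θ : ℂ)) :=
    continuous_const.div (by fun_prop) hne
  have i1 : IntegrableOn (fun θ : ℝ => ω / (2 * Real.pi) * source ψ (Real.cos θ₀) s *
      (1 / (1 + s * (Real.cos θ : ℂ)))) (Ioo (-Real.pi) Real.pi) :=
    ((hcont.integrableOn_Icc).mono_set Ioo_subset_Icc_self).const_mul _
  have hpt : (fun θ => laplace (ψ θ) s) =ᵐ[volume.restrict (Ioo (-Real.pi) Real.pi)]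
      fun θ => (Real.cos θ : ℂ) * (ψ θ 0 : ℂ) / (1 + s * (Real.cos θ : ℂ)) +
        ω / (2 * Real.pi) * source ψ (Real.cos θ₀) s * (1 / (1 + s * (Real.cos θ : ℂ))) := by
    refine ae_angle fun θ hθ hcos => ?_
    have h := hψ.laplace_transport hμ hs hθ hcos
    simp only
    rw [mul_one_div, ← add_div, eq_div_iff (hne θ)]
    linear_combination h
  have i2 : IntegrableOn (fun θ : ℝ => (Real.cos θ : ℂ) * (ψ θ 0 : ℂ) /
      (1 + s * (Real.cos θ : ℂ))) (Ioo (-Real.pi) Real.pi) := by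
    refine ((hψ.integrable_laplace_angle hs).sub i1).congr ?_
    filter_upwards [hpt] with θ h
    simp only [Pi.sub_apply]
    rw [h]; ring
  have hang := integral_angular habs
  rw [intervalIntegral.integral_of_le (by linarith [Real.pi_pos]), integral_Ioc_eq_integral_Ioo]
    at hang
  have h := hψ.laplace_density_eq hs
  rw [integral_congr_ae hpt, integral_add i2 i1, integral_const_mul, hang] at h
  have hpi : (Real.pi : ℂ) ≠ 0 := ofReal_ne_zero.2 Real.pi_ne_zero
  have hsrc : source ψ (Real.cos θ₀) s = laplace (photonDensity ψ) s +
    (Real.cos θ₀ : ℂ) / (1 + (Real.cos θ₀ : ℂ) * s) := rfl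
  have hw := stripSqrt_ne_zero habs
  have e : (ω : ℂ) / (2 * Real.pi) * source ψ (Real.cos θ₀) s * (2 * Real.pi / stripSqrt s) =
      source ψ (Real.cos θ₀) s * ((ω : ℂ) / stripSqrt s) := by field_simp
  rw [e] at h
  rw [boundaryTerm]
  linear_combination h + hsrc

end IsDiffuseFlux

namespace IsDiffuseFlux

variable {ω θ₀ β : ℝ} {ψ : ℝ → ℝ → ℝ}

/-- The side of the Wiener-Hopf equation that is analytic in the right half-plane. -/
noncomputable def rightSide (ω μ₀ β : ℝ) (ψ : ℝ → ℝ → ℝ) (s : ℂ) : ℂ :=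
  source ψ μ₀ s * ((s + sPlus ω) / (s + 1) * (1 + μ₀ * s) * (kappaMinus ω β s)⁻¹)

/-- The side of the Wiener-Hopf equation that is analytic in the left half-plane `Re s < β`. -/
noncomputable def leftSide (ω μ₀ β : ℝ) (ψ : ℝ → ℝ → ℝ) (s : ℂ) : ℂ :=
  (μ₀ + (1 + μ₀ * s) * boundaryTerm ψ s) * ((s - 1) / (s - sPlus ω)) * (kappaPlus ω β s)⁻¹

lemma sub_sPlus_ne_zero {s : ℂ} (hβ : β < sPlus ω) (hs : s.re < β) : s - (sPlus ω : ℂ) ≠ 0 := by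
  intro h
  have := congrArg re h
  simp at this
  linarith

lemma rightSide_eq_leftSide (hψ : IsDiffuseFlux ω θ₀ ψ) (h₀ : 0 ≤ ω) (h₁ : ω < 1)
    (hμ : 0 < Real.cos θ₀) (hβ₁ : β < sPlus ω) {s : ℂ} (hs : 0 < s.re) (hsβ : s.re < β) :
    rightSide ω (Real.cos θ₀) β ψ s = leftSide ω (Real.cos θ₀) β ψ s := by
  have habs : |s.re| < β := by rwa [abs_of_pos hs]
  have hs1 : s.re < 1 := hsβ.trans (hβ₁.trans_le (sPlus_le_one ω))
  have hWH := hψ.wienerHopf hμ hs hs1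
  rw [one_sub_div_stripSqrt h₀ h₁ (habs.trans hβ₁), ← kappa_eq h₀ h₁ (habs.trans hβ₁),
    kappa_eq_div h₀ h₁ hβ₁ habs] at hWH
  have k1 : kappaPlus ω β s ≠ 0 := cauchyExp_ne_zero _ _ _
  have k2 : kappaMinus ω β s ≠ 0 := cauchyExp_ne_zero _ _ _
  have n1 := one_add_mul_ne_zero hμ hs
  have n2 := sub_sPlus_ne_zero hβ₁ hsβ
  have n3 : s - 1 ≠ 0 := fun h => by
    rw [sub_eq_zero.1 h] at hs1; simp at hs1
  have n4 : s + 1 ≠ 0 := ne_zero_of_re_pos (by simp; linarith)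
  have e : s ^ 2 - 1 = (s - 1) * (s + 1) := by ring
  rw [e, show s ^ 2 - (sPlus ω : ℂ) ^ 2 = (s - sPlus ω) * (s + sPlus ω) by ring] at hWH
  rw [rightSide, leftSide]
  have hE : (Real.cos θ₀ : ℂ) + (1 + Real.cos θ₀ * s) * boundaryTerm ψ s =
      (1 + Real.cos θ₀ * s) * ((Real.cos θ₀ : ℂ) / (1 + (Real.cos θ₀ : ℂ) * s) +
        boundaryTerm ψ s) := by
    rw [mul_add, mul_div_cancel₀ _ n1]
  rw [hE, ← hWH]
  field_simp

lemma differentiableAt_rightSide (hψ : IsDiffuseFlux ω θ₀ ψ) (h₀ : 0 ≤ ω) (h₁ : ω < 1)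
    (hμ : 0 < Real.cos θ₀) (hβ₀ : 0 < β) (hβ₁ : β < sPlus ω) {s : ℂ} (hs : 0 < s.re) :
    DifferentiableAt ℂ (rightSide ω (Real.cos θ₀) β ψ) s := by
  have hk : DifferentiableAt ℂ (kappaMinus ω β) s :=
    differentiableAt_cauchyExp h₀ h₁ (by rwa [abs_neg, abs_of_pos hβ₀]) (by linarith)
  have hG : DifferentiableAt ℂ (source ψ (Real.cos θ₀)) s :=
    (differentiableAt_laplace hψ.laplace_density hs).add
      (DifferentiableAt.fun_div (by fun_prop) (by fun_prop) (one_add_mul_ne_zero hμ hs))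
  refine hG.mul (DifferentiableAt.mul (DifferentiableAt.mul
    (DifferentiableAt.fun_div (by fun_prop) (by fun_prop) ?_) (by fun_prop))
    (hk.inv (cauchyExp_ne_zero _ _ _)))
  exact ne_zero_of_re_pos (by simp; linarith)

lemma differentiableAt_leftSide (hψ : IsDiffuseFlux ω θ₀ ψ) (h₀ : 0 ≤ ω) (h₁ : ω < 1)
    (hμ : 0 < Real.cos θ₀) (hβ₀ : 0 < β) (hβ₁ : β < sPlus ω) {s : ℂ} (hs : s.re < β) :
    DifferentiableAt ℂ (leftSide ω (Real.cos θ₀) β ψ) s := by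
  have hk : DifferentiableAt ℂ (kappaPlus ω β) s :=
    differentiableAt_cauchyExp h₀ h₁ (by rwa [abs_of_pos hβ₀]) hs.ne
  have hE : DifferentiableAt ℂ (boundaryTerm ψ) s :=
    hψ.differentiableAt_boundaryTerm hμ (hs.trans (hβ₁.trans_le (sPlus_le_one ω)))
  refine DifferentiableAt.mul (DifferentiableAt.mul (DifferentiableAt.const_add _
    (DifferentiableAt.mul (by fun_prop) hE))
    (DifferentiableAt.fun_div (by fun_prop) (by fun_prop) (sub_sPlus_ne_zero hβ₁ hs)))
    (hk.inv (cauchyExp_ne_zero _ _ _))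

lemma norm_one_add_mul_le {μ : ℝ} (h : 0 < μ) (h1 : μ ≤ 1) (s : ℂ) :
    ‖1 + (μ : ℂ) * s‖ ≤ 1 + ‖s‖ := by
  refine (norm_add_le _ _).trans ?_
  rw [norm_one, norm_mul, norm_real, Real.norm_of_nonneg h.le]
  gcongr
  exact mul_le_of_le_one_left (norm_nonneg _) h1

lemma norm_add_sPlus_div_le {s : ℂ} (hs : 0 < s.re) : ‖(s + sPlus ω) / (s + 1)‖ ≤ 1 := by
  have h1 : 0 < ‖s + 1‖ := norm_pos_iff.2 (ne_zero_of_re_pos (by simp; linarith))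
  rw [norm_div, div_le_one h1]
  refine abs_le_of_sq_le_sq' ?_ (norm_nonneg _) |>.2
  have := sPlus_le_one ω
  have h0 : 0 ≤ sPlus ω := Real.sqrt_nonneg _
  rw [← normSq_eq_norm_sq, ← normSq_eq_norm_sq, normSq_apply, normSq_apply]
  simp
  nlinarith

lemma norm_right_factor_le {C : ℝ} {s : ℂ} (hμ : 0 < Real.cos θ₀) (hs : 0 < s.re)
    (hC : ‖(kappaMinus ω β s)⁻¹‖ ≤ C) :
    ‖(s + sPlus ω) / (s + 1) * (1 + (Real.cos θ₀ : ℂ) * s) * (kappaMinus ω β s)⁻¹‖ ≤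
      C * (1 + ‖s‖) := by
  rw [norm_mul, norm_mul]
  have h1 := norm_add_sPlus_div_le (ω := ω) hs
  have h2 := norm_one_add_mul_le hμ (Real.cos_le_one θ₀) s
  calc _ ≤ 1 * (1 + ‖s‖) * C := by gcongr
    _ = C * (1 + ‖s‖) := by ring

lemma norm_source_tail_le (hμ : 0 < Real.cos θ₀) {s : ℂ} (hs : 0 < s.re) :
    ‖(Real.cos θ₀ : ℂ) / (1 + (Real.cos θ₀ : ℂ) * s)‖ ≤ 1 := by
  have h1 : (1 : ℝ) ≤ ‖1 + (Real.cos θ₀ : ℂ) * s‖ := by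
    refine le_trans ?_ (re_le_norm _)
    have : 0 < Real.cos θ₀ * s.re := mul_pos hμ hs
    simp only [add_re, one_re, re_ofReal_mul]; linarith
  rw [norm_div, norm_real, Real.norm_of_nonneg hμ.le]
  exact (div_le_one (by linarith)).2 ((Real.cos_le_one _).trans h1)

lemma tendsto_source_zero (hψ : IsDiffuseFlux ω θ₀ ψ) (hμ : 0 < Real.cos θ₀) :
    Tendsto (fun x : ℝ => source ψ (Real.cos θ₀) x) atTop (𝓝 0) := by
  have h2 : Tendsto (fun x : ℝ => Real.cos θ₀ / (1 + Real.cos θ₀ * x)) atTop (𝓝 0) :=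
    (tendsto_atTop_add_const_left _ _ (tendsto_id.const_mul_atTop hμ)).const_div_atTop _
  have h3 := (continuous_ofReal.tendsto 0).comp h2
  rw [ofReal_zero] at h3
  have h4 := (tendsto_laplace_zero hψ.laplace_density).add h3
  rw [add_zero] at h4
  refine h4.congr fun x => ?_
  simp [source]

lemma exists_wienerHopf_const (hψ : IsDiffuseFlux ω θ₀ ψ) (h₀ : 0 ≤ ω) (h₁ : ω < 1)
    (hμ : 0 < Real.cos θ₀) (hβ₀ : 0 < β) (hβ₁ : β < sPlus ω) :
    ∃ J : ℂ, (∀ s : ℂ, 0 < s.re → rightSide ω (Real.cos θ₀) β ψ s = J) ∧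
      ∀ s : ℂ, s.re < β → leftSide ω (Real.cos θ₀) β ψ s = J := by
  have hp1 := sPlus_le_one ω
  set m := β / 2 with hm
  have hm0 : 0 < m := half_pos hβ₀
  obtain ⟨Cm, hCm0, hCm⟩ := exists_bound_cauchyExp h₀ h₁ (c := -β)
    (by rwa [abs_neg, abs_of_pos hβ₀]) hβ₀
  obtain ⟨Cp, hCp0, hCp⟩ := exists_bound_cauchyExp h₀ h₁ (c := β) (by rwa [abs_of_pos hβ₀]) hm0
  obtain ⟨A, hA0, hA⟩ := exists_bound_laplace hψ.laplace_density hm0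
  have hkm : ∀ s : ℂ, 0 < s.re → ‖(kappaMinus ω β s)⁻¹‖ ≤ Cm := fun s hs =>
    (hCm s (by rw [abs_sub_comm, sub_neg_eq_add]; exact le_trans (by linarith) (le_abs_self _))).2
  have hkp : ∀ s : ℂ, s.re ≤ m → ‖(kappaPlus ω β s)⁻¹‖ ≤ Cp := fun s hs =>
    (hCp s (le_trans (by linarith) (le_abs_self _))).2
  set B := (∫ θ in Ioo (-Real.pi) Real.pi, ‖(Real.cos θ : ℂ) * (ψ θ 0 : ℂ)‖) / (1 - m) with hB
  have hE : ∀ s : ℂ, s.re ≤ m → ‖boundaryTerm ψ s‖ ≤ B := fun s hs =>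
    hψ.norm_boundaryTerm_le hμ hm0.le (by linarith) hs
  have hB0 : 0 ≤ B := (norm_nonneg _).trans (hE 0 (by simpa using hm0.le))
  have hpm : 0 < sPlus ω - m := by linarith
  refine exists_const_of_overlap hm0 (half_lt_self hβ₀) (C₁ := (A + 1) * Cm)
    (C₂ := (1 + B) * (1 + 1 / (sPlus ω - m)) * Cp)
    (fun s hs => hψ.differentiableAt_rightSide h₀ h₁ hμ hβ₀ hβ₁ hs)
    (fun s hs => hψ.differentiableAt_leftSide h₀ h₁ hμ hβ₀ hβ₁ hs)
    (fun s hs hs' => hψ.rightSide_eq_leftSide h₀ h₁ hμ hβ₁ hs hs') ?_ ?_ ?_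
  · intro s hs
    have hs0 := hm0.trans_le hs
    have h1 : ‖source ψ (Real.cos θ₀) s‖ ≤ A + 1 :=
      (norm_add_le _ _).trans (add_le_add (hA s hs) (norm_source_tail_le hμ hs0))
    have h2 := norm_right_factor_le hμ hs0 (hkm s hs0)
    rw [rightSide, norm_mul, mul_assoc (A + 1)]
    exact mul_le_mul h1 h2 (norm_nonneg _) (by positivity)
  · intro s hs
    have h1 : ‖(Real.cos θ₀ : ℂ) + (1 + Real.cos θ₀ * s) * boundaryTerm ψ s‖ ≤
        (1 + B) * (1 + ‖s‖) := by
      refine (norm_add_le _ _).trans ?_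
      rw [norm_mul, norm_real, Real.norm_of_nonneg hμ.le]
      have := mul_le_mul (norm_one_add_mul_le hμ (Real.cos_le_one θ₀) s) (hE s hs)
        (norm_nonneg _) (by positivity)
      nlinarith [Real.cos_le_one θ₀, norm_nonneg s]
    have h2 : ‖(s - 1) / (s - sPlus ω)‖ ≤ 1 + 1 / (sPlus ω - m) := by
      have hn := sub_sPlus_ne_zero hβ₁ (s := s) (by linarith)
      have hlow : sPlus ω - m ≤ ‖s - sPlus ω‖ := by
        rw [norm_sub_rev]
        refine le_trans ?_ (re_le_norm _)
        simp only [sub_re, ofReal_re]; linarith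
      have e : (s - 1) / (s - sPlus ω) = 1 + ((sPlus ω - 1 : ℝ) : ℂ) / (s - sPlus ω) := by
        field_simp; push_cast; ring
      rw [e]
      refine (norm_add_le _ _).trans ?_
      rw [norm_one, norm_div, norm_real]
      have h0 : 0 ≤ sPlus ω := Real.sqrt_nonneg _
      have : ‖sPlus ω - 1‖ ≤ 1 := by
        rw [Real.norm_eq_abs, abs_le]; constructor <;> linarith
      gcongr
    rw [leftSide, norm_mul, norm_mul]
    calc _ ≤ (1 + B) * (1 + ‖s‖) * (1 + 1 / (sPlus ω - m)) * Cp := by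
          gcongr
          exact hkp s hs
      _ = _ := by ring
  · have hlim := ((hψ.tendsto_source_zero hμ).norm.mul_const (2 * Cm))
    rw [norm_zero, zero_mul] at hlim
    refine squeeze_zero_norm' ?_ hlim
    filter_upwards [eventually_ge_atTop 1] with x hx
    have hx0 : 0 < x := by linarith
    have hxre : 0 < (x : ℂ).re := by simpa using hx0
    have h2 := norm_right_factor_le hμ hxre (hkm x hxre)
    rw [norm_real, Real.norm_of_nonneg hx0.le] at h2
    rw [norm_div, norm_real, Real.norm_of_nonneg hx0.le, div_le_iff₀ hx0, rightSide, norm_mul,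
      mul_assoc _ (2 * Cm)]
    exact mul_le_mul_of_nonneg_left (h2.trans (by nlinarith)) (norm_nonneg _)

lemma source_eq (hψ : IsDiffuseFlux ω θ₀ ψ) (h₀ : 0 ≤ ω) (h₁ : ω < 1)
    (hμ : 0 < Real.cos θ₀) (hβ₀ : 0 < β) (hβ₁ : β < sPlus ω) {s : ℂ} (hs : 0 < s.re) :
    source ψ (Real.cos θ₀) s =
      (Real.cos θ₀ : ℂ) * (1 + Real.cos θ₀) /
        (kappaPlus ω β (-1 / (Real.cos θ₀ : ℂ)) * (1 + Real.cos θ₀ * sPlus ω)) *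
          ((s + 1) * kappaMinus ω β s / ((s + sPlus ω) * (1 + Real.cos θ₀ * s))) := by
  obtain ⟨J, hJr, hJl⟩ := hψ.exists_wienerHopf_const h₀ h₁ hμ hβ₀ hβ₁
  have hp0 : 0 ≤ sPlus ω := Real.sqrt_nonneg _
  have hr := hJr s hs
  have hl := hJl (-1 / (Real.cos θ₀ : ℂ)) (by
    have e : (-1 / (Real.cos θ₀ : ℂ)) = ((-1 / Real.cos θ₀ : ℝ) : ℂ) := by push_cast; rfl
    rw [e, ofReal_re]
    exact (div_neg_of_neg_of_pos (by norm_num) hμ).trans hβ₀)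
  have k1 : kappaPlus ω β (-1 / (Real.cos θ₀ : ℂ)) ≠ 0 := cauchyExp_ne_zero _ _ _
  have k2 : kappaMinus ω β s ≠ 0 := cauchyExp_ne_zero _ _ _
  rw [rightSide] at hr
  rw [leftSide] at hl
  have n0 : (Real.cos θ₀ : ℂ) ≠ 0 := ofReal_ne_zero.2 hμ.ne'
  have n1 := one_add_mul_ne_zero hμ hs
  have n2 : s + 1 ≠ 0 := ne_zero_of_re_pos (by simp; linarith)
  have n3 : s + (sPlus ω : ℂ) ≠ 0 := ne_zero_of_re_pos (by simp; linarith)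
  have n4 : 1 + (Real.cos θ₀ : ℂ) * (sPlus ω : ℂ) ≠ 0 := by
    have : 0 < 1 + Real.cos θ₀ * sPlus ω := by positivity
    exact_mod_cast this.ne'
  rw [mul_div_cancel₀ _ n0, add_neg_cancel, zero_mul, add_zero] at hl
  have e : ((-1 / (Real.cos θ₀ : ℂ) - 1) / (-1 / (Real.cos θ₀ : ℂ) - sPlus ω)) =
      (1 + Real.cos θ₀) / (1 + Real.cos θ₀ * sPlus ω) := by
    rw [show -1 / (Real.cos θ₀ : ℂ) - 1 = -(1 + Real.cos θ₀) / Real.cos θ₀ by field_simp; ring,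
      show -1 / (Real.cos θ₀ : ℂ) - sPlus ω = -(1 + Real.cos θ₀ * sPlus ω) / Real.cos θ₀ by
        field_simp; ring, div_div_div_cancel_right₀ n0, neg_div_neg_eq]
  rw [e, ← hr] at hl
  have hl' : source ψ (Real.cos θ₀) s = ((Real.cos θ₀ : ℂ) *
      ((1 + Real.cos θ₀) / (1 + Real.cos θ₀ * sPlus ω)) *
      (kappaPlus ω β (-1 / (Real.cos θ₀ : ℂ)))⁻¹) /
      ((s + sPlus ω) / (s + 1) * (1 + Real.cos θ₀ * s) * (kappaMinus ω β s)⁻¹) := by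
    rw [eq_div_iff]
    · exact hl.symm
    · exact mul_ne_zero (mul_ne_zero (div_ne_zero n3 n2) n1) (inv_ne_zero k2)
  rw [hl']
  field_simp

/-- The emergent flux is read off from the transport equation at `s = -1 / μ`. -/
lemma emergent_eq_source (hψ : IsDiffuseFlux ω θ₀ ψ) (hμ : 0 < Real.cos θ₀) {θ : ℝ}
    (hθ : θ ∈ Ioo (-Real.pi) Real.pi) (hcos : Real.cos θ < 0) :
    (ψ θ 0 : ℂ) = -((ω : ℂ) / (2 * Real.pi * Real.cos θ)) *
      source ψ (Real.cos θ₀) (-1 / (Real.cos θ : ℂ)) := by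
  have hre : 0 < (-1 / (Real.cos θ : ℂ)).re := by
    have e : (-1 / (Real.cos θ : ℂ)) = ((-1 / Real.cos θ : ℝ) : ℂ) := by push_cast; rfl
    rw [e, ofReal_re]
    exact div_pos_of_neg_of_neg (by norm_num) hcos
  have n0 : (Real.cos θ : ℂ) ≠ 0 := ofReal_ne_zero.2 hcos.ne
  have hpi : (Real.pi : ℂ) ≠ 0 := ofReal_ne_zero.2 Real.pi_ne_zero
  have h := hψ.laplace_transport hμ hre hθ hcos.ne
  rw [div_mul_cancel₀ _ n0, add_neg_cancel, zero_mul] at h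
  field_simp at h ⊢
  linear_combination -h

end IsDiffuseFlux

end Albedo

open Albedo in
theorem mainTheorem1 (ω : ℝ) (hω₀ : 0 ≤ ω) (hω₁ : ω < 1)
    (θ₀ μ₀ : ℝ) (hθ₀ : |θ₀| < Real.pi / 2) (hμ₀ : μ₀ = Real.cos θ₀)
    (β : ℝ) (hβ₀ : 0 < β) (hβ₁ : β < sPlus ω)
    (ψ : ℝ → ℝ → ℝ) (hψ : IsDiffuseFlux ω θ₀ ψ) :
    -- the angular integral behind `κ`
    (∀ s : ℂ, |s.re| < 1 →
      (∫ θ in (-Real.pi)..Real.pi, 1 / (1 + s * (Real.cos θ : ℂ))) =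
        2 * (Real.pi : ℂ) * Complex.I / branchSqrt s) ∧
    -- the factors `κ₊`, `κ₋` are well defined, analytic in overlapping half-planes, and split `κ`
    (∀ s : ℂ, s.re < β → Integrable (contourIntegrand ω β s)) ∧
    (∀ s : ℂ, -β < s.re → Integrable (contourIntegrand ω (-β) s)) ∧
    DifferentiableOn ℂ (kappaPlus ω β) {s : ℂ | s.re < β} ∧
    DifferentiableOn ℂ (kappaMinus ω β) {s : ℂ | -β < s.re} ∧
    (∀ s : ℂ, |s.re| < β → kappa ω s = kappaPlus ω β s / kappaMinus ω β s) ∧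
    -- the Laplace-transformed photon density
    (∀ s : ℂ, 0 < s.re →
      laplace (photonDensity ψ) s =
        (μ₀ : ℂ) * (1 + μ₀) / (kappaPlus ω β (-1 / (μ₀ : ℂ)) * (1 + μ₀ * sPlus ω)) *
          ((s + 1) * kappaMinus ω β s / ((s + sPlus ω) * (1 + μ₀ * s)))
        - (μ₀ : ℂ) / (1 + μ₀ * s)) ∧
    -- the emergent diffuse flux, in its equivalent forms
    (∀ θ μ : ℝ, Real.pi / 2 < |θ| → |θ| < Real.pi → μ = Real.cos θ →
      ((ψ θ 0 : ℝ) : ℂ) =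
        -((ω : ℂ) / (2 * Real.pi * μ)) * laplace (photonDensity ψ) (-1 / (μ : ℂ))
          + (ω : ℂ) / (2 * Real.pi) * ((μ₀ : ℂ) / (μ₀ - μ)) ∧
      ((ψ θ 0 : ℝ) : ℂ) =
        (ω : ℂ) / (2 * Real.pi) *
          ((μ₀ : ℂ) * (1 + μ₀) * (1 - μ) * kappaMinus ω β (-1 / (μ : ℂ)) /
            ((μ₀ - μ) * (1 + μ₀ * sPlus ω) * (1 - μ * sPlus ω) *
              kappaPlus ω β (-1 / (μ₀ : ℂ)))) ∧
      ((ψ θ 0 : ℝ) : ℂ) =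
        (ω : ℂ) / (2 * Real.pi) *
          ((μ₀ : ℂ) * (1 + μ₀) * (1 - μ) /
            ((μ₀ - μ) * (1 + μ₀ * sPlus ω) * (1 - μ * sPlus ω))) *
          (kappaMinus ω β (1 / (μ₀ : ℂ)) * kappaMinus ω β (-1 / (μ : ℂ))) ∧
      ((ψ θ 0 : ℝ) : ℂ) =
        (ω : ℂ) / (2 * Real.pi) *
          ((μ₀ : ℂ) * (1 + μ₀) * (1 - μ) /
            ((μ₀ - μ) * (1 + μ₀ * sPlus ω) * (1 - μ * sPlus ω))) *
          (1 / (kappaPlus ω β (-1 / (μ₀ : ℂ)) * kappaPlus ω β (1 / (μ : ℂ))))) := by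
  have hμpos : 0 < Real.cos θ₀ := Real.cos_pos_of_mem_Ioo (abs_lt.1 hθ₀)
  subst hμ₀
  have hβ : |β| < sPlus ω := by rwa [abs_of_pos hβ₀]
  have hβ' : |-β| < sPlus ω := by rwa [abs_neg]
  have hp0 : 0 ≤ sPlus ω := Real.sqrt_nonneg _
  refine ⟨fun s hs => ?_, fun s hs => integrable_contourIntegrand hω₀ hω₁ hβ hs.ne,
    fun s hs => integrable_contourIntegrand hω₀ hω₁ hβ' hs.ne',
    fun s hs => (differentiableAt_cauchyExp hω₀ hω₁ hβ (ne_of_lt hs)).differentiableWithinAt,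
    fun s hs => (differentiableAt_cauchyExp hω₀ hω₁ hβ' (ne_of_gt hs)).differentiableWithinAt,
    fun s hs => kappa_eq_div hω₀ hω₁ hβ₁ hs, fun s hs => ?_, ?_⟩
  · rw [integral_angular hs, branchSqrt_eq, mul_comm (2 * (Real.pi : ℂ)),
      mul_div_mul_left _ _ Complex.I_ne_zero]
  · rw [← hψ.source_eq hω₀ hω₁ hμpos hβ₀ hβ₁ hs, IsDiffuseFlux.source, add_sub_cancel_right]
  · intro θ μ hθ1 hθ2 hμ
    have hcos : Real.cos θ < 0 := by
      rw [← Real.cos_abs]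
      exact Real.cos_neg_of_pi_div_two_lt_of_lt hθ1 (by linarith [Real.pi_pos])
    have hem := hψ.emergent_eq_source hμpos (abs_lt.1 hθ2) hcos
    rw [← hμ] at hcos hem
    have hre : 0 < (-1 / (μ : ℂ)).re := by
      have e : (-1 / (μ : ℂ)) = ((-1 / μ : ℝ) : ℂ) := by push_cast; rfl
      rw [e, Complex.ofReal_re]
      exact div_pos_of_neg_of_neg (by norm_num) hcos
    have n0 : (μ : ℂ) ≠ 0 := Complex.ofReal_ne_zero.2 hcos.ne
    have n1 : (Real.cos θ₀ : ℂ) - μ ≠ 0 := by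
      exact_mod_cast (sub_pos.2 (hcos.trans hμpos)).ne'
    have n2 : 1 - (μ : ℂ) * (sPlus ω : ℂ) ≠ 0 := by
      have : 0 < 1 - μ * sPlus ω := by nlinarith
      exact_mod_cast this.ne'
    have hpi : (Real.pi : ℂ) ≠ 0 := Complex.ofReal_ne_zero.2 Real.pi_ne_zero
    have n3 : 1 + (Real.cos θ₀ : ℂ) * (sPlus ω : ℂ) ≠ 0 := by
      have : 0 < 1 + Real.cos θ₀ * sPlus ω := by positivity
      exact_mod_cast this.ne'
    have d1 : 1 + (Real.cos θ₀ : ℂ) * (-1 / (μ : ℂ)) = -((Real.cos θ₀ - μ) / μ) := by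
      field_simp; ring
    have d2 : -1 / (μ : ℂ) + sPlus ω = -((1 - μ * sPlus ω) / μ) := by field_simp; ring
    have d3 : -1 / (μ : ℂ) + 1 = -((1 - μ) / μ) := by field_simp; ring
    have k0 : kappaPlus ω β (-1 / (Real.cos θ₀ : ℂ)) ≠ 0 := cauchyExp_ne_zero _ _ _
    have k1 : kappaMinus ω β (1 / (Real.cos θ₀ : ℂ)) =
        (kappaPlus ω β (-1 / (Real.cos θ₀ : ℂ)))⁻¹ := by
      rw [kappaMinus, kappaPlus, ← cauchyExp_neg, neg_div, neg_neg]
    have k2 : kappaMinus ω β (-1 / (μ : ℂ)) = (kappaPlus ω β (1 / (μ : ℂ)))⁻¹ := by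
      rw [kappaMinus, kappaPlus, ← cauchyExp_neg, neg_div]
    have hsecond : ((ψ θ 0 : ℝ) : ℂ) = (ω : ℂ) / (2 * Real.pi) *
        ((Real.cos θ₀ : ℂ) * (1 + Real.cos θ₀) * (1 - μ) * kappaMinus ω β (-1 / (μ : ℂ)) /
          ((Real.cos θ₀ - μ) * (1 + Real.cos θ₀ * sPlus ω) * (1 - μ * sPlus ω) *
            kappaPlus ω β (-1 / (Real.cos θ₀ : ℂ)))) := by
      rw [hem, hψ.source_eq hω₀ hω₁ hμpos hβ₀ hβ₁ hre, d1, d2, d3]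
      field_simp
    have hthird : ((ψ θ 0 : ℝ) : ℂ) = (ω : ℂ) / (2 * Real.pi) *
        ((Real.cos θ₀ : ℂ) * (1 + Real.cos θ₀) * (1 - μ) /
          ((Real.cos θ₀ - μ) * (1 + Real.cos θ₀ * sPlus ω) * (1 - μ * sPlus ω))) *
        (kappaMinus ω β (1 / (Real.cos θ₀ : ℂ)) * kappaMinus ω β (-1 / (μ : ℂ))) := by
      rw [hsecond, k1]
      field_simp
    refine ⟨?_, hsecond, hthird, ?_⟩
    · rw [hem, IsDiffuseFlux.source, d1]
      field_simp
      ring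
    · rw [hthird, k1, k2, ← mul_inv, one_div (kappaPlus _ _ _ * _)]
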